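/- Theorem 1.3. Work over an algebraically closed field $\Bbbk$ of characteristic zero. For a lattice $N$ (a free abelian group of finite rank) write $N\otimes\mathbb{G}_m$ for the torus with cocharacter lattice $N$, and for a rational polyhedral cone $\sigma\subseteq N\otimes\mathbb{R}$ let $N_\sigma$ be the lattice of points of $N$ in the linear span of $\sigma$ and $T_\sigma=N_\sigma\otimes\mathbb{G}_m$. Let $X$ be a toric variety with its toric boundary, let $\Sigma$ be its fan (a finite fan of strictly convex rational polyhedral cones in $N_\Sigma\otimes\mathbb{R}$), and let $\tau\subseteq N_\tau\otimes\mathbb{R}$ be a strictly convex, full-dimensional rational polyhedral cone, with affine toric variety $U_\tau$, torus-fixed point $0\in U_\tau$ and dense torus $T_\tau=N_\tau\otimes\mathbb{G}_m$ (the rubber torus). Let $\Upsilon$ be a tropical expansion of $\Sigma$ over $\tau$: a finite fan in $(N_\Sigma\times N_\tau)\otimes\mathbb{R}$, each of whose cones is contained in $\sigma\times\tau$ for some $\sigma\in\Sigma$ (it need not cover $|\Sigma\times\tau|$), such that the projection $\mathrm p$ to $N_\tau\otimes\mathbb{R}$ maps every cone $\omega$ of $\Upsilon$ onto a face of $\tau$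 and maps $N_\omega$ onto the lattice of that face. Let $\mathcal{X}_\Upsilon$ be the toric variety of $\Upsilon$, $\pi\colon\mathcal{X}_\Upsilon\to U_\tau$ the toric morphism given by $\mathrm p$, and $Y_\Upsilon=\pi^{-1}(0)$ the central fibre. The rubber action of $T_\tau$ on $\mathcal{X}_\Upsilon$ is the restriction of the action of the dense torus $(N_\Sigma\times N_\tau)\otimes\mathbb{G}_m=T_\Sigma\times T_\tau$ to its second factor. Let $v$ be a vertex of the polyhedral subdivision $\mathrm p^{-1}(\mathrm f)$, $\mathrm f$ an interior point of $\tau$, that is, a cone $\omega_v\in\Upsilon$ that $\mathrm p$ maps bijectively onto $\tau$. Let $\sigma_v$ be the minimal cone of $\Sigma$ that contains the projection of $\omega_v$, let $\varphi_v\colon\tau\to\sigma_v$ be the tropical position map, $\varphi_v(\mathrm f)=\mathrm r(\omega_v\cap\mathrm p^{-1}(\mathrm f))$ with $\mathrm r$ the projection to $N_\Sigma\otimes\mathbb{R}$, together with the induced homomorphism $N_\tau\to N_{\sigma_v}$. Let $Y_v\subseteq\mathcal{X}_\Upsilon$ be the toric stratum of $\omega_v$, i.e. the closure of its torus orbit $T_v=N_v\otimes\mathbb{G}_m$,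 where $N_v=(N_\Sigma\times N_\tau)/N_{\omega_v}$. Then $Y_v$ is a closed subscheme of $Y_\Upsilon$ whose underlying set is an irreducible component of $Y_\Upsilon$, and $T_v$ is a dense open subscheme of $Y_v$. There is an injective homomorphism $\iota\colon N_{\sigma_v}\hookrightarrow N_v$ with $$\iota(\varphi_v(h)-g)=[(g,h)]\qquad\text{for all } g\in N_{\sigma_v},\ h\in N_\tau,$$ and $\iota\otimes\mathbb{G}_m\colon T_{\sigma_v}\hookrightarrow T_v$ is a homomorphism of tori and a closed immersion. There is an action of $T_v$ on $Y_v$ that extends the multiplication of $T_v$, and the rubber action of $T_\tau$ restricts to $Y_v$, where it is the action of $T_v$ composed with the homomorphism $$T_\tau\xrightarrow{\ \varphi_v\otimes\mathbb{G}_m\ }T_{\sigma_v}\xrightarrow{\ \iota\otimes\mathbb{G}_m\ }T_v .$$ -/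

import Mathlib

open CategoryTheory Limits AlgebraicGeometry
open scoped MonoidalCategory

universe u

namespace Toric

noncomputable section

/-! ### Lattices and cones -/

section Cones

variable {N N' : Type u} [AddCommGroup N] [AddCommGroup N']

variable (N) in
/-- The real vector space `N ⊗ ℝ` of a lattice `N`. -/
abbrev RealSpace : Type u := TensorProduct ℤ ℝ N

variable (N) in
/-- The embedding of a lattice in its real vector space. -/
def latticeIncl : N →ₗ[ℤ] RealSpace N := TensorProduct.mk ℤ ℝ N 1

/-- The linear map `N ⊗ ℝ → N' ⊗ ℝ` induced by a homomorphism of lattices. -/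
def realMap (f : N →ₗ[ℤ] N') : RealSpace N →ₗ[ℝ] RealSpace N' := f.baseChange ℝ

/-- The linear functional on `N ⊗ ℝ` given by an element `m` of the dual lattice. -/
def pairing (m : Module.Dual ℤ N) : RealSpace N →ₗ[ℝ] ℝ :=
  Module.Dual.baseChange ℝ m

variable (N) in
/-- Convex cones in `N ⊗ ℝ`. -/
abbrev RealCone : Type u := PointedCone ℝ (RealSpace N)

/-- `σ` is generated by finitely many lattice vectors. -/
def IsRationalPolyhedral (σ : RealCone N) : Prop :=
  ∃ s : Finset N, σ = PointedCone.hull ℝ (latticeIncl N '' s)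

/-- `σ` contains no line. -/
def IsStrictlyConvex (σ : RealCone N) : Prop := ∀ x ∈ σ, -x ∈ σ → x = 0

/-- `σ` spans the vector space `N ⊗ ℝ`. -/
def IsFullDimensional (σ : RealCone N) : Prop := Submodule.span ℝ (σ : Set (RealSpace N)) = ⊤

/-- The monoid `σ^∨ ∩ N^∨` of integral functionals that are nonnegative on `σ`. -/
def dualMonoid (σ : RealCone N) : AddSubmonoid (Module.Dual ℤ N) where
  carrier := {m | ∀ x ∈ σ, 0 ≤ pairing m x}
  zero_mem' := by intro x _; simp [pairing]
  add_mem' := by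
    intro a b ha hb x hx
    have := add_nonneg (ha x hx) (hb x hx)
    simpa [pairing] using this

/-- `σ'` is a face of `σ`: it is cut out of `σ` by the vanishing of an integral functional that is
nonnegative on `σ`. -/
def IsFace (σ' σ : RealCone N) : Prop :=
  ∃ m ∈ dualMonoid σ, ∀ x, x ∈ σ' ↔ x ∈ σ ∧ pairing m x = 0

/-- The lattice `N_σ` of a cone `σ`: the lattice points in the linear span of `σ`. -/
def latticeOf (σ : RealCone N) : Submodule ℤ N :=
  ((Submodule.span ℝ (σ : Set (RealSpace N))).restrictScalars ℤ).comap (latticeIncl N)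

variable (N) in
/-- Fans of strictly convex rational polyhedral cones: finite sets of such cones that contain all
faces of their members, and in which any two members meet in a face of each. -/
structure Fan where
  cones : Set (RealCone N)
  finite : cones.Finite
  rational : ∀ σ ∈ cones, IsRationalPolyhedral σ
  strictlyConvex : ∀ σ ∈ cones, IsStrictlyConvex σ
  face_mem : ∀ σ ∈ cones, ∀ σ', IsFace σ' σ → σ' ∈ cones
  inf_face : ∀ σ ∈ cones, ∀ σ' ∈ cones, IsFace (σ ⊓ σ') σ

lemma pairing_add (m m' : Module.Dual ℤ N) (x : RealSpace N) :
    pairing (m + m') x = pairing m x + pairing m' x := by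
  simp [pairing]

lemma pairing_nsmul (n : ℕ) (m : Module.Dual ℤ N) (x : RealSpace N) :
    pairing (n • m) x = n * pairing m x := by
  induction n with
  | zero => simp [pairing]
  | succ n ih => rw [succ_nsmul, pairing_add, ih]; push_cast; ring

lemma pairing_latticeIncl (m : Module.Dual ℤ N) (n : N) :
    pairing m (latticeIncl N n) = (m n : ℝ) := by
  change pairing m (TensorProduct.tmul ℤ (1 : ℝ) n) = _
  simp [pairing]

lemma dualMonoid_anti {σ σ' : RealCone N} (h : σ ≤ σ') : dualMonoid σ' ≤ dualMonoid σ :=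
  fun _ hm x hx => hm x (h hx)

/-- A functional that is nonnegative on a face becomes nonnegative on the cone after adding a
multiple of a functional that cuts out the face. -/
lemma exists_add_nsmul_mem {σ' σ : RealCone N} (hσ : IsRationalPolyhedral σ) {m : Module.Dual ℤ N}
    (hm : m ∈ dualMonoid σ) (hface : ∀ x, x ∈ σ' ↔ x ∈ σ ∧ pairing m x = 0)
    {p : Module.Dual ℤ N} (hp : p ∈ dualMonoid σ') :
    ∃ n : ℕ, p + n • m ∈ dualMonoid σ := by
  obtain ⟨s, rfl⟩ := hσ
  have hs : ∀ v ∈ s, latticeIncl N v ∈ PointedCone.hull ℝ (latticeIncl N '' s) :=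
    fun v hv => PointedCone.subset_hull ⟨v, hv, rfl⟩
  refine ⟨∑ v ∈ s, (p v).natAbs, ?_⟩
  set n := ∑ v ∈ s, (p v).natAbs with hn
  suffices h : ∀ v ∈ s, 0 ≤ pairing (p + n • m) (latticeIncl N v) by
    intro x hx
    refine Submodule.span_induction (p := fun x _ => 0 ≤ pairing (p + n • m) x) ?_ ?_ ?_ ?_ hx
    · rintro _ ⟨v, hv, rfl⟩; exact h v hv
    · simp
    · intro x y _ _ hx hy; rw [map_add]; exact add_nonneg hx hy
    · intro a x _ hx
      have : pairing (p + n • m) (a • x) = (a : ℝ) * pairing (p + n • m) x := by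
        rw [← smul_eq_mul, ← map_smul]; rfl
      rw [this]; exact mul_nonneg a.2 hx
  intro v hv
  have h1 := hm _ (hs v hv)
  rw [pairing_add, pairing_nsmul]
  rcases h1.eq_or_lt with h0 | hpos
  · rw [← h0, mul_zero, add_zero]
    exact hp _ ((hface _).2 ⟨hs v hv, h0.symm⟩)
  · rw [pairing_latticeIncl] at hpos ⊢
    rw [pairing_latticeIncl]
    have h2 : (1 : ℤ) ≤ m v := by exact_mod_cast hpos
    have h3 : (p v).natAbs ≤ n := Finset.single_le_sum (f := fun v => (p v).natAbs)
      (fun _ _ => Nat.zero_le _) hv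
    have h4 : (0 : ℤ) ≤ p v + n * m v := by
      have h5 : -((p v).natAbs : ℤ) ≤ p v := by omega
      have h6 : ((p v).natAbs : ℤ) ≤ n := by exact_mod_cast h3
      nlinarith
    exact_mod_cast h4

lemma realMap_latticeIncl (f : N →ₗ[ℤ] N') (n : N) :
    realMap f (latticeIncl N n) = latticeIncl N' (f n) := by
  change realMap f (TensorProduct.tmul ℤ (1 : ℝ) n) = TensorProduct.tmul ℤ (1 : ℝ) (f n)
  simp [realMap]

lemma latticeIncl_injective [Module.Free ℤ N] : Function.Injective (latticeIncl N) := by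
  have h : Function.Injective (LinearMap.rTensor N (Algebra.linearMap ℤ ℝ)) :=
    Module.Flat.rTensor_preserves_injective_linearMap _ Int.cast_injective
  intro a b hab
  have e : ∀ n : N, latticeIncl N n =
      LinearMap.rTensor N (Algebra.linearMap ℤ ℝ) (TensorProduct.tmul ℤ 1 n) := by
    intro n
    rw [LinearMap.rTensor_tmul, Algebra.linearMap_apply, map_one]
    rfl
  rw [e, e] at hab
  simpa using congrArg (TensorProduct.lid ℤ N) (h hab)

lemma mem_span_cone {σ : RealCone N} {x : RealSpace N}
    (hx : x ∈ Submodule.span ℝ (σ : Set (RealSpace N))) : ∃ a ∈ σ, ∃ b ∈ σ, x = a - b := by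
  have hsmul : ∀ (c : ℝ), 0 ≤ c → ∀ y ∈ σ, c • y ∈ σ := fun c hc y hy =>
    PointedCone.smul_mem σ hc hy
  induction hx using Submodule.span_induction with
  | mem x hx => exact ⟨x, hx, 0, zero_mem _, (sub_zero x).symm⟩
  | zero => exact ⟨0, zero_mem _, 0, zero_mem _, (sub_zero 0).symm⟩
  | add x y _ _ hx hy =>
    obtain ⟨a, ha, b, hb, rfl⟩ := hx
    obtain ⟨a', ha', b', hb', rfl⟩ := hy
    exact ⟨a + a', add_mem ha ha', b + b', add_mem hb hb', by abel⟩
  | smul c x _ hx =>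
    obtain ⟨a, ha, b, hb, rfl⟩ := hx
    rcases le_total 0 c with hc | hc
    · exact ⟨c • a, hsmul c hc a ha, c • b, hsmul c hc b hb, smul_sub _ _ _⟩
    · refine ⟨(-c) • b, hsmul _ (by linarith) b hb, (-c) • a, hsmul _ (by linarith) a ha, ?_⟩
      rw [← smul_sub, neg_smul, ← smul_neg, neg_sub]

end Cones

section Glue
variable {S : Scheme.{u}} (T X Y : Over S) (𝒰 : X.left.OpenCover)

/-- A member of an open cover of `X`, as a scheme over the base of `X`. -/
abbrev coverObj (i : 𝒰.I₀) : Over S := Over.mk (𝒰.f i ≫ X.hom)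

/-- The inclusion of a member of an open cover. -/
abbrev coverIncl (i : 𝒰.I₀) : coverObj X 𝒰 i ⟶ X := Over.homMk (𝒰.f i) rfl

/-- The base change of a member of an open cover of `X` to the product `T ⊗ X` maps to the product
of `T` and the member. -/
def coverProdMap (i : 𝒰.I₀) :
    pullback (SemiCartesianMonoidalCategory.snd T X).left (𝒰.f i) ⟶ (T ⊗ coverObj X 𝒰 i).left :=
  pullback.lift (pullback.fst _ _ ≫ (SemiCartesianMonoidalCategory.fst T X).left)
    (pullback.snd _ _) (by
      have h := pullback.condition (f := (SemiCartesianMonoidalCategory.snd T X).left)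
        (g := 𝒰.f i)
      have h1 := Over.w (SemiCartesianMonoidalCategory.fst T X)
      have h2 := Over.w (SemiCartesianMonoidalCategory.snd T X)
      rw [Category.assoc, h1, ← h2, ← Category.assoc, h]
      simp)

lemma coverProdMap_fst (i : 𝒰.I₀) : coverProdMap T X 𝒰 i ≫
    (SemiCartesianMonoidalCategory.fst T (coverObj X 𝒰 i)).left =
      pullback.fst _ _ ≫ (SemiCartesianMonoidalCategory.fst T X).left :=
  pullback.lift_fst _ _ _

lemma coverProdMap_snd (i : 𝒰.I₀) : coverProdMap T X 𝒰 i ≫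
    (SemiCartesianMonoidalCategory.snd T (coverObj X 𝒰 i)).left = pullback.snd _ _ :=
  pullback.lift_snd _ _ _

lemma prod_left_ext {Z : Scheme.{u}} {A B : Over S} {f g : Z ⟶ (A ⊗ B).left}
    (h₁ : f ≫ (SemiCartesianMonoidalCategory.fst A B).left =
      g ≫ (SemiCartesianMonoidalCategory.fst A B).left)
    (h₂ : f ≫ (SemiCartesianMonoidalCategory.snd A B).left =
      g ≫ (SemiCartesianMonoidalCategory.snd A B).left) : f = g :=
  pullback.hom_ext h₁ h₂

lemma coverProdMap_whisker (i : 𝒰.I₀) :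
    coverProdMap T X 𝒰 i ≫ (T ◁ coverIncl X 𝒰 i).left = pullback.fst _ _ := by
  apply prod_left_ext
  · rw [Category.assoc, ← Over.comp_left, CartesianMonoidalCategory.whiskerLeft_fst,
      coverProdMap_fst]
  · rw [Category.assoc, ← Over.comp_left, CartesianMonoidalCategory.whiskerLeft_snd,
      Over.comp_left, ← Category.assoc, coverProdMap_snd]
    exact pullback.condition.symm

/-- The inverse of `coverProdMap`. -/
def coverProdInv (i : 𝒰.I₀) :
    (T ⊗ coverObj X 𝒰 i).left ⟶ pullback (SemiCartesianMonoidalCategory.snd T X).left (𝒰.f i) :=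
  pullback.lift (T ◁ coverIncl X 𝒰 i).left
    (SemiCartesianMonoidalCategory.snd T (coverObj X 𝒰 i)).left (by
      rw [← Over.comp_left, CartesianMonoidalCategory.whiskerLeft_snd]; rfl)

lemma coverProdInv_map (i : 𝒰.I₀) : coverProdInv T X 𝒰 i ≫ coverProdMap T X 𝒰 i = 𝟙 _ := by
  apply prod_left_ext
  · rw [Category.assoc, coverProdMap_fst, ← Category.assoc]
    unfold coverProdInv
    rw [pullback.lift_fst, ← Over.comp_left, CartesianMonoidalCategory.whiskerLeft_fst,
      Category.id_comp]
  · rw [Category.assoc, coverProdMap_snd]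
    unfold coverProdInv
    rw [pullback.lift_snd, Category.id_comp]

lemma glueProd_aux₂ {T X Y : Over S} {𝒰 : X.left.OpenCover}
    (g : ∀ i, T ⊗ coverObj X 𝒰 i ⟶ Y) (i : 𝒰.I₀) :
    (coverProdMap T X 𝒰 i ≫ (g i).left) ≫ Y.hom =
      pullback.fst (SemiCartesianMonoidalCategory.snd T X).left (𝒰.f i) ≫ (T ⊗ X).hom := by
  rw [Category.assoc, Over.w, ← coverProdMap_whisker T X 𝒰 i, Category.assoc, Over.w]

variable [Category* 𝒰.I₀] [𝒰.LocallyDirected]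

/-- The transition map of a directed open cover. -/
abbrev coverTrans {i j : 𝒰.I₀} (f : i ⟶ j) : coverObj X 𝒰 i ⟶ coverObj X 𝒰 j :=
  Over.homMk (𝒰.trans f) (by
    change 𝒰.trans f ≫ 𝒰.f j ≫ X.hom = 𝒰.f i ≫ X.hom
    rw [← Category.assoc, 𝒰.trans_map])

lemma trans_coverProdMap {i j : 𝒰.I₀} (f : i ⟶ j) :
    pullback.map (SemiCartesianMonoidalCategory.snd T X).left (𝒰.f i) _ (𝒰.f j) (𝟙 _)
        (𝒰.trans f) (𝟙 _) (by simp) (by simp) ≫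
      coverProdMap T X 𝒰 j = coverProdMap T X 𝒰 i ≫ (T ◁ coverTrans X 𝒰 f).left := by
  apply prod_left_ext
  · rw [Category.assoc, coverProdMap_fst, Category.assoc, ← Over.comp_left,
      CartesianMonoidalCategory.whiskerLeft_fst, coverProdMap_fst, pullback.lift_fst_assoc,
      Category.comp_id]
  · rw [Category.assoc, coverProdMap_snd, Category.assoc, ← Over.comp_left,
      CartesianMonoidalCategory.whiskerLeft_snd, Over.comp_left, ← Category.assoc,
      coverProdMap_snd, pullback.lift_snd]
    rfl

/-- The open cover of `T ⊗ X` induced by an open cover of `X`. -/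
abbrev prodCover : (T ⊗ X).left.OpenCover :=
  Precoverage.ZeroHypercover.pullback₁ (SemiCartesianMonoidalCategory.snd T X).left 𝒰

section
variable {T X Y 𝒰} (g : ∀ i, T ⊗ coverObj X 𝒰 i ⟶ Y)

lemma glueProd_aux₁
    (h : ∀ {i j : 𝒰.I₀} (f : i ⟶ j), (T ◁ coverTrans X 𝒰 f) ≫ g j = g i)
    {i j : 𝒰.I₀} (f : i ⟶ j) :
    pullback.map (SemiCartesianMonoidalCategory.snd T X).left (𝒰.f i) _ (𝒰.f j) (𝟙 _)
        (𝒰.trans f) (𝟙 _) (by simp) (by simp) ≫ coverProdMap T X 𝒰 j ≫ (g j).left =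
      coverProdMap T X 𝒰 i ≫ (g i).left := by
  rw [← Category.assoc, trans_coverProdMap, Category.assoc, ← Over.comp_left, h]

/-- A morphism from a product `T ⊗ X` can be glued from morphisms on the products of `T` with the
members of a directed open cover of `X`. -/
def glueProd
    (h : ∀ {i j : 𝒰.I₀} (f : i ⟶ j), (T ◁ coverTrans X 𝒰 f) ≫ g j = g i) : T ⊗ X ⟶ Y :=
  Scheme.OpenCover.glueMorphismsOverOfLocallyDirected (X := T ⊗ X) (prodCover T X 𝒰)
    (fun i => coverProdMap T X 𝒰 i ≫ (g i).left) (glueProd_aux₁ g h) (glueProd_aux₂ g)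

lemma whisker_glueProd
    (h : ∀ {i j : 𝒰.I₀} (f : i ⟶ j), (T ◁ coverTrans X 𝒰 f) ≫ g j = g i)
    (i : 𝒰.I₀) : (T ◁ coverIncl X 𝒰 i) ≫ glueProd g h = g i := by
  apply Over.OverMorphism.ext
  have := Scheme.OpenCover.map_glueMorphismsOverOfLocallyDirected_left (X := T ⊗ X)
    (prodCover T X 𝒰) (fun i => coverProdMap T X 𝒰 i ≫ (g i).left) (glueProd_aux₁ g h)
    (glueProd_aux₂ g) i
  have e : (T ◁ coverIncl X 𝒰 i).left = coverProdInv T X 𝒰 i ≫ pullback.fst _ _ :=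
    (pullback.lift_fst _ _ _).symm
  rw [Over.comp_left, e, Category.assoc]
  refine (congrArg (coverProdInv T X 𝒰 i ≫ ·) this).trans ?_
  refine (Category.assoc _ _ _).symm.trans ?_
  exact (congrArg (· ≫ (g i).left) (coverProdInv_map T X 𝒰 i)).trans (Category.id_comp _)

end

end Glue

/-- The morphism `G ⊗ X ⟶ X` of an action of a monoid object `G` on `X`. -/
abbrev actionHom {S : Scheme.{u}} {G X : Over S} [MonObj G] (A : ModObj G X) : G ⊗ X ⟶ X :=
  A.smul

/-! ### Toric varieties -/

section Charts
variable {N N' : Type u} [AddCommGroup N] [AddCommGroup N']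
variable (k : Type u) [Field k]

/-- The coordinate ring `k[σ^∨ ∩ N^∨]` of the affine toric variety `U_σ`. -/
abbrev coordRing (σ : RealCone N) : Type u := AddMonoidAlgebra k (dualMonoid σ)

/-- The inclusion of coordinate rings dual to an inclusion of cones. -/
def restrictHom {σ σ' : RealCone N} (h : σ ≤ σ') : coordRing k σ' →ₐ[k] coordRing k σ :=
  AddMonoidAlgebra.mapDomainAlgHom k k (AddSubmonoid.inclusion (dualMonoid_anti h))

lemma restrictHom_single {σ σ' : RealCone N} (h : σ ≤ σ') (m : dualMonoid σ') (a : k) :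
    restrictHom k h (AddMonoidAlgebra.single m a) =
      AddMonoidAlgebra.single (AddSubmonoid.inclusion (dualMonoid_anti h) m) a := by
  simp [restrictHom]

lemma restrictHom_injective {σ σ' : RealCone N} (h : σ ≤ σ') :
    Function.Injective (restrictHom k h) :=
  AddMonoidAlgebra.mapDomain_injective (AddSubmonoid.inclusion_injective _)

lemma isLocalization_restrictHom {σ' σ : RealCone N} (hσ : IsRationalPolyhedral σ) (h : σ' ≤ σ)
    (m : dualMonoid σ) (hface : ∀ x, x ∈ σ' ↔ x ∈ σ ∧ pairing m.1 x = 0) :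
    letI := (restrictHom k h).toRingHom.toAlgebra
    IsLocalization.Away (AddMonoidAlgebra.single m (1 : k)) (coordRing k σ') := by
  let := (restrictHom k h).toRingHom.toAlgebra
  have hneg : -m.1 ∈ dualMonoid σ' := by
    intro x hx
    have h0 := ((hface x).1 hx).2
    have h1 : pairing (-m.1) x + pairing m.1 x = 0 := by
      rw [← pairing_add]; simp [pairing]
    linarith
  have hpow : ∀ n : ℕ, (AddMonoidAlgebra.single m (1 : k)) ^ n =
      (AddMonoidAlgebra.single (n • m) 1 : coordRing k σ) := by
    intro n; rw [AddMonoidAlgebra.single_pow]; simp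
  have halg : ∀ x : coordRing k σ, algebraMap (coordRing k σ) (coordRing k σ') x =
    restrictHom k h x := fun _ => rfl
  refine ⟨?_, ?_, ?_⟩
  · rintro ⟨_, n, rfl⟩
    simp only [map_pow]
    refine IsUnit.pow _ ?_
    refine IsUnit.of_mul_eq_one (AddMonoidAlgebra.single ⟨-m.1, hneg⟩ 1) ?_
    rw [halg, restrictHom_single, AddMonoidAlgebra.single_mul_single, AddMonoidAlgebra.one_def]
    congr 1
    · ext1; simp
    · simp
  · intro z
    induction z using AddMonoidAlgebra.induction_linear with
    | zero => exact ⟨(0, 1), by simp⟩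
    | add f g hf hg =>
      obtain ⟨⟨a, s⟩, ha⟩ := hf
      obtain ⟨⟨b, t⟩, hb⟩ := hg
      refine ⟨(a * t.1 + b * s.1, s * t), ?_⟩
      simp only [Submonoid.coe_mul, map_mul, map_add] at ha hb ⊢
      rw [← ha, ← hb]; ring
    | single p a =>
      obtain ⟨n, hn⟩ := exists_add_nsmul_mem hσ m.2 hface p.2
      refine ⟨(AddMonoidAlgebra.single ⟨_, hn⟩ a, ⟨_, n, rfl⟩), ?_⟩
      dsimp only
      rw [hpow, halg, halg, restrictHom_single, restrictHom_single,
        AddMonoidAlgebra.single_mul_single]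
      congr 1
      · simp
  · intro x y hxy
    exact ⟨1, by rw [restrictHom_injective k h hxy]⟩


/-- The affine `k`-scheme `Spec A`. -/
abbrev affine (k A : Type u) [Field k] [CommRing A] [Algebra k A] :
    Over (Spec (CommRingCat.of k)) :=
  (Spec (CommRingCat.of A)).asOver (Spec (CommRingCat.of k))

/-- The morphism of affine `k`-schemes given by a homomorphism of `k`-algebras. -/
abbrev affineMap {A B : Type u} [CommRing A] [CommRing B] [Algebra k A] [Algebra k B]
    (f : A →ₐ[k] B) : affine k B ⟶ affine k A :=
  (Spec.map (CommRingCat.ofHom f.toRingHom)).asOver (Spec (CommRingCat.of k))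

/-- The affine toric variety `U_σ`. -/
abbrev affineToric (σ : RealCone N) : Over (Spec (CommRingCat.of k)) := affine k (coordRing k σ)

/-- The morphism `U_σ ⟶ U_σ'` for cones `σ ≤ σ'`. -/
abbrev chartMap {σ σ' : RealCone N} (h : σ ≤ σ') : affineToric k σ ⟶ affineToric k σ' :=
  affineMap k (restrictHom k h)

lemma restrictHom_self (σ : RealCone N) : restrictHom k (le_refl σ) = AlgHom.id k _ := by
  refine AddMonoidAlgebra.algHom_ext (fun m => ?_) (by ext)
  rw [restrictHom_single]; rfl

lemma restrictHom_comp {σ σ' σ'' : RealCone N} (h : σ ≤ σ') (h' : σ' ≤ σ'') :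
    (restrictHom k h).comp (restrictHom k h') = restrictHom k (h.trans h') := by
  refine AddMonoidAlgebra.algHom_ext (fun m => ?_) (by ext)
  rw [AlgHom.comp_apply, restrictHom_single, restrictHom_single, restrictHom_single]; rfl

lemma isOpenImmersion_chartMap {σ' σ : RealCone N} (hσ : IsRationalPolyhedral σ) (h : σ' ≤ σ)
    (hface : IsFace σ' σ) : IsOpenImmersion (chartMap k h).left := by
  obtain ⟨m, hm, hf⟩ := hface
  let := (restrictHom k h).toRingHom.toAlgebra
  have := isLocalization_restrictHom k hσ h ⟨m, hm⟩ hf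
  exact IsOpenImmersion.of_isLocalization (S := coordRing k σ')
    (AddMonoidAlgebra.single (⟨m, hm⟩ : dualMonoid σ) (1 : k))

lemma range_chartMap {σ' σ : RealCone N} (hσ : IsRationalPolyhedral σ) (h : σ' ≤ σ)
    (m : dualMonoid σ) (hface : ∀ x, x ∈ σ' ↔ x ∈ σ ∧ pairing m.1 x = 0) :
    Set.range (chartMap k h).left =
      (PrimeSpectrum.basicOpen (AddMonoidAlgebra.single m (1 : k)) :
        Set (PrimeSpectrum (coordRing k σ))) := by
  let := (restrictHom k h).toRingHom.toAlgebra
  have := isLocalization_restrictHom k hσ h m hface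
  exact PrimeSpectrum.localization_away_comap_range (coordRing k σ')
    (AddMonoidAlgebra.single m (1 : k))

lemma Fan.isFace_of_le (Δ : Fan N) {σ σ' : RealCone N} (hσ : σ ∈ Δ.cones) (hσ' : σ' ∈ Δ.cones)
    (h : σ ≤ σ') : IsFace σ σ' := by
  have := Δ.inf_face σ' hσ' σ hσ
  rwa [inf_eq_right.2 h] at this

lemma IsFace.le {σ σ' : RealCone N} (h : IsFace σ σ') : σ ≤ σ' := by
  obtain ⟨m, -, hf⟩ := h
  exact fun x hx => ((hf x).1 hx).1

lemma Fan.inf_mem (Δ : Fan N) {σ σ' : RealCone N} (hσ : σ ∈ Δ.cones) (hσ' : σ' ∈ Δ.cones) :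
    σ ⊓ σ' ∈ Δ.cones := Δ.face_mem σ hσ _ (Δ.inf_face σ hσ σ' hσ')

/-- The diagram of affine toric varieties `U_σ`, for `σ` in the fan ordered by inclusion. -/
def chartFunctor (Δ : Fan N) : {σ // σ ∈ Δ.cones} ⥤ Scheme.{u} where
  obj σ := (affineToric k σ.1).left
  map f := (chartMap k (leOfHom f)).left
  map_id σ := by
    change Spec.map (CommRingCat.ofHom (restrictHom k (le_refl σ.1)).toRingHom) = _
    rw [restrictHom_self]
    exact Spec.map_id _
  map_comp f g := by
    change Spec.map _ = Spec.map _ ≫ Spec.map _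
    rw [← Spec.map_comp, ← restrictHom_comp k (leOfHom f) (leOfHom g)]
    rfl

instance isOpenImmersion_map (Δ : Fan N) {σ σ' : {σ // σ ∈ Δ.cones}} (f : σ ⟶ σ') :
    IsOpenImmersion ((chartFunctor k Δ).map f) :=
  isOpenImmersion_chartMap k (Δ.rational _ σ'.2) (leOfHom f)
    (Δ.isFace_of_le σ.2 σ'.2 (leOfHom f))

instance (Δ : Fan N) : (chartFunctor k Δ ⋙ Scheme.forget).IsLocallyDirected where
  cond {i j l} fi fj xi xj hx := by
    change (chartFunctor k Δ).map fi xi = (chartFunctor k Δ).map fj xj at hx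
    obtain ⟨m₁, hm₁, h₁⟩ := Δ.isFace_of_le i.2 l.2 (leOfHom fi)
    obtain ⟨m₂, hm₂, h₂⟩ := Δ.isFace_of_le j.2 l.2 (leOfHom fj)
    let t : {σ // σ ∈ Δ.cones} := ⟨i.1 ⊓ j.1, Δ.inf_mem i.2 j.2⟩
    let ti : t ⟶ i := homOfLE (show i.1 ⊓ j.1 ≤ i.1 from inf_le_left)
    let tj : t ⟶ j := homOfLE (show i.1 ⊓ j.1 ≤ j.1 from inf_le_right)
    have ht : ∀ x, x ∈ t.1 ↔ x ∈ l.1 ∧ pairing (m₁ + m₂) x = 0 := by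
      intro x
      rw [pairing_add]
      change x ∈ i.1 ⊓ j.1 ↔ _
      rw [Submodule.mem_inf, h₁, h₂]
      constructor
      · rintro ⟨⟨hl, e₁⟩, -, e₂⟩; exact ⟨hl, by rw [e₁, e₂, add_zero]⟩
      · rintro ⟨hl, e⟩
        have a₁ := hm₁ x hl
        have a₂ := hm₂ x hl
        exact ⟨⟨hl, by linarith⟩, hl, by linarith⟩
    have r₁ : (chartFunctor k Δ).map fi xi ∈ Set.range (chartMap k (leOfHom fi)).left := ⟨xi, rfl⟩
    have r₂ : (chartFunctor k Δ).map fi xi ∈ Set.range (chartMap k (leOfHom fj)).left :=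
      ⟨xj, hx.symm⟩
    have r₃ : (chartFunctor k Δ).map fi xi ∈
        Set.range (chartMap k (leOfHom (ti ≫ fi))).left := by
      rw [range_chartMap k (Δ.rational _ l.2) _ ⟨m₁ + m₂, add_mem hm₁ hm₂⟩ ht]
      rw [range_chartMap k (Δ.rational _ l.2) _ ⟨m₁, hm₁⟩ h₁] at r₁
      rw [range_chartMap k (Δ.rational _ l.2) _ ⟨m₂, hm₂⟩ h₂] at r₂
      have e : (AddMonoidAlgebra.single (⟨m₁ + m₂, add_mem hm₁ hm₂⟩ : dualMonoid l.1) (1 : k)) =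
          AddMonoidAlgebra.single ⟨m₁, hm₁⟩ 1 * AddMonoidAlgebra.single ⟨m₂, hm₂⟩ 1 := by
        rw [AddMonoidAlgebra.single_mul_single, mul_one]; rfl
      rw [e, PrimeSpectrum.basicOpen_mul]
      exact ⟨r₁, r₂⟩
    obtain ⟨y, hy⟩ := r₃
    refine ⟨t, ti, tj, y, ?_, ?_⟩
    · apply ((chartFunctor k Δ).map fi).isOpenEmbedding.injective
      refine Eq.trans ?_ hy
      exact (congr($((chartFunctor k Δ).map_comp ti fi) y)).symm
    · apply ((chartFunctor k Δ).map fj).isOpenEmbedding.injective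
      rw [← hx]
      refine Eq.trans ?_ hy
      exact (congr($((chartFunctor k Δ).map_comp tj fj) y)).symm

/-- The toric variety of a fan: the gluing of the affine toric varieties `U_σ` along the open
immersions `U_σ ⟶ U_σ'` for `σ ≤ σ'`. -/
def toricVariety (Δ : Fan N) : Over (Spec (CommRingCat.of k)) :=
  Over.mk (colimit.desc (chartFunctor k Δ)
    { pt := Spec (CommRingCat.of k)
      ι := { app := fun σ => (affineToric k σ.1).hom
             naturality := fun _ _ f => (Over.w (chartMap k (leOfHom f))).trans
              (Category.comp_id _).symm } })

/-- The open immersion `U_σ ⟶ X_Δ` of the chart of a cone `σ` of `Δ`. -/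
def chart (Δ : Fan N) (σ : {σ // σ ∈ Δ.cones}) : affineToric k σ.1 ⟶ toricVariety k Δ :=
  Over.homMk (colimit.ι (chartFunctor k Δ) σ) (by exact colimit.ι_desc _ _)

/-- The covering of a toric variety by its charts. -/
def chartCover (Δ : Fan N) : (toricVariety k Δ).left.OpenCover :=
  Scheme.IsLocallyDirected.openCover (chartFunctor k Δ)

variable (N) in
/-- The torus `N ⊗ 𝔾ₘ` with its group structure. -/
abbrev torus : Over (Spec (CommRingCat.of k)) := affine k (AddMonoidAlgebra k (Module.Dual ℤ N))

/-- The homomorphism of tori `f ⊗ 𝔾ₘ` given by a homomorphism of lattices `f`. -/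
def torusMap (f : N →ₗ[ℤ] N') : torus N k ⟶ torus N' k :=
  affineMap k (AddMonoidAlgebra.mapDomainAlgHom k k f.dualMap.toAddMonoidHom)

/-- The coaction `χ^m ↦ χ^m ⊗ χ^m` of the torus on the affine toric variety of `σ`. -/
def coaction (σ : RealCone N) : coordRing k σ →ₐ[k]
    TensorProduct k (AddMonoidAlgebra k (Module.Dual ℤ N)) (coordRing k σ) :=
  (Algebra.TensorProduct.map (AddMonoidAlgebra.mapDomainAlgHom k k (dualMonoid σ).subtype)
    (AlgHom.id k _)).comp (Bialgebra.comulAlgHom k (coordRing k σ))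

lemma coaction_single (σ : RealCone N) (m : dualMonoid σ) :
    coaction k σ (AddMonoidAlgebra.single m 1) =
      TensorProduct.tmul k (AddMonoidAlgebra.single m.1 1) (AddMonoidAlgebra.single m 1) := by
  simp [coaction]

/-- The product of affine `k`-schemes. -/
def affineProd (A B : Type u) [CommRing A] [CommRing B] [Algebra k A] [Algebra k B] :
    affine k A ⊗ affine k B ≅ affine k (TensorProduct k A B) :=
  Over.isoMk (pullbackSpecIso k A B) (by exact pullbackSpecIso_hom_base k A B)

/-- The action of the torus on the affine toric variety of `σ`. -/
def affineAction (σ : RealCone N) : torus N k ⊗ affineToric k σ ⟶ affineToric k σ :=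
  (affineProd k _ _).hom ≫ affineMap k (coaction k σ)


lemma affineProd_hom_fst (A B : Type u) [CommRing A] [CommRing B] [Algebra k A] [Algebra k B] :
    (affineProd k A B).hom ≫ affineMap k Algebra.TensorProduct.includeLeft =
      SemiCartesianMonoidalCategory.fst (affine k A) (affine k B) :=
  Over.OverMorphism.ext (by exact pullbackSpecIso_hom_fst k A B)

lemma affineProd_hom_snd (A B : Type u) [CommRing A] [CommRing B] [Algebra k A] [Algebra k B] :
    (affineProd k A B).hom ≫ affineMap k Algebra.TensorProduct.includeRight =
      SemiCartesianMonoidalCategory.snd (affine k A) (affine k B) :=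
  Over.OverMorphism.ext (by exact pullbackSpecIso_hom_snd k A B)

lemma affineMap_comp {A B C : Type u} [CommRing A] [CommRing B] [CommRing C] [Algebra k A]
    [Algebra k B] [Algebra k C] (f : A →ₐ[k] B) (g : B →ₐ[k] C) :
    affineMap k g ≫ affineMap k f = affineMap k (g.comp f) :=
  Over.OverMorphism.ext (by exact (Spec.map_comp _ _).symm)

lemma affineProd_natural {A B C : Type u} [CommRing A] [CommRing B] [CommRing C] [Algebra k A]
    [Algebra k B] [Algebra k C] (f : B →ₐ[k] C) :
    (affine k A ◁ affineMap k f) ≫ (affineProd k A B).hom =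
      (affineProd k A C).hom ≫ affineMap k (Algebra.TensorProduct.map (AlgHom.id k A) f) := by
  rw [← cancel_mono (affineProd k A B).inv, Category.assoc, Iso.hom_inv_id, Category.comp_id]
  refine CartesianMonoidalCategory.hom_ext _ _ ?_ ?_
  · rw [CartesianMonoidalCategory.whiskerLeft_fst]
    rw [← affineProd_hom_fst k A B, ← affineProd_hom_fst k A C]
    simp only [Category.assoc, Iso.inv_hom_id_assoc]
    rw [affineMap_comp]
    congr 2
    ext x
    simp
  · rw [CartesianMonoidalCategory.whiskerLeft_snd]
    rw [← affineProd_hom_snd k A B, ← affineProd_hom_snd k A C]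
    simp only [Category.assoc, Iso.inv_hom_id_assoc]
    rw [affineMap_comp, affineMap_comp]
    congr 2

lemma affineAction_natural {σ σ' : RealCone N} (h : σ ≤ σ') :
    (torus N k ◁ chartMap k h) ≫ affineAction k σ' = affineAction k σ ≫ chartMap k h := by
  unfold affineAction
  rw [← Category.assoc, affineProd_natural, Category.assoc, Category.assoc, affineMap_comp,
    affineMap_comp]
  congr 2
  refine AddMonoidAlgebra.algHom_ext (fun m => ?_) (by ext)
  rw [AlgHom.comp_apply, AlgHom.comp_apply, coaction_single, restrictHom_single, coaction_single]
  rw [Algebra.TensorProduct.map_tmul, restrictHom_single]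
  rfl

instance (Δ : Fan N) : Category (chartCover k Δ).I₀ :=
  inferInstanceAs (Category {σ // σ ∈ Δ.cones})

instance (Δ : Fan N) : (chartCover k Δ).LocallyDirected where
  trans {i j} f := (chartFunctor k Δ).map f
  trans_id i := (chartFunctor k Δ).map_id i
  trans_comp f g := (chartFunctor k Δ).map_comp f g
  w f := colimit.w (chartFunctor k Δ) f
  directed {i j} x := by
    have hx : colimit.ι (chartFunctor k Δ) i
        (pullback.fst ((chartCover k Δ).f i) ((chartCover k Δ).f j) x) =
        colimit.ι (chartFunctor k Δ) j
          (pullback.snd ((chartCover k Δ).f i) ((chartCover k Δ).f j) x) :=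
      congr($(pullback.condition (f := (chartCover k Δ).f i) (g := (chartCover k Δ).f j)) x)
    obtain ⟨l, fi, fj, y, h₁, -⟩ := Scheme.IsLocallyDirected.ι_eq_ι_iff (chartFunctor k Δ) |>.1 hx
    refine ⟨l, fi, fj, y, ?_⟩
    apply (pullback.fst ((chartCover k Δ).f i) ((chartCover k Δ).f j)).isOpenEmbedding.injective
    refine Eq.trans ?_ h₁
    exact congr($(pullback.lift_fst (f := (chartCover k Δ).f i) (g := (chartCover k Δ).f j)
      ((chartFunctor k Δ).map fi) ((chartFunctor k Δ).map fj)
      ((colimit.w (chartFunctor k Δ) fi).trans (colimit.w (chartFunctor k Δ) fj).symm)) y)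
  property_trans {i j} f := isOpenImmersion_map k Δ f

lemma chartMap_chart (Δ : Fan N) {σ σ' : {σ // σ ∈ Δ.cones}} (f : σ ⟶ σ') :
    chartMap k (leOfHom f) ≫ chart k Δ σ' = chart k Δ σ :=
  Over.OverMorphism.ext (by exact colimit.w (chartFunctor k Δ) f)

/-- The identification of a member of the cover by charts with an affine toric variety. -/
def coverToChart (Δ : Fan N) (σ : {σ // σ ∈ Δ.cones}) :
    coverObj (toricVariety k Δ) (chartCover k Δ) σ ≅ affineToric k σ.1 :=
  Over.isoMk (Iso.refl _) (by
    refine (Category.id_comp _).trans ?_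
    exact (Over.w (chart k Δ σ)).symm)

lemma coverToChart_chart (Δ : Fan N) (σ : {σ // σ ∈ Δ.cones}) :
    (coverToChart k Δ σ).hom ≫ chart k Δ σ = coverIncl (toricVariety k Δ) (chartCover k Δ) σ :=
  Over.OverMorphism.ext (by exact Category.id_comp _)

lemma coverTrans_coverToChart (Δ : Fan N) {σ σ' : {σ // σ ∈ Δ.cones}} (f : σ ⟶ σ') :
    coverTrans (toricVariety k Δ) (chartCover k Δ) f ≫ (coverToChart k Δ σ').hom =
      (coverToChart k Δ σ).hom ≫ chartMap k (leOfHom f) :=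
  Over.OverMorphism.ext (by exact (Category.comp_id _).trans (Category.id_comp _).symm)

lemma chartAction_compatible (Δ : Fan N) {σ σ' : (chartCover k Δ).I₀} (f : σ ⟶ σ') :
    (torus N k ◁ coverTrans (toricVariety k Δ) (chartCover k Δ) f) ≫
        (torus N k ◁ (coverToChart k Δ σ').hom) ≫ affineAction k _ ≫ chart k Δ σ' =
      (torus N k ◁ (coverToChart k Δ σ).hom) ≫ affineAction k _ ≫ chart k Δ σ := by
  rw [← MonoidalCategory.whiskerLeft_comp_assoc]
  refine (congrArg (fun a => (torus N k ◁ a) ≫ affineAction k σ'.1 ≫ chart k Δ σ')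
    (coverTrans_coverToChart k Δ f)).trans ?_
  rw [MonoidalCategory.whiskerLeft_comp_assoc, ← Category.assoc (_ ◁ chartMap _ _),
    affineAction_natural, Category.assoc]
  exact congrArg (fun a => (torus N k ◁ (coverToChart k Δ σ).hom) ≫ affineAction k σ.1 ≫ a)
    (chartMap_chart k Δ f)

/-- The action of the torus `N ⊗ 𝔾ₘ` on the toric variety of a fan in `N`, obtained by gluing the
actions on the charts. -/
def torusAction (Δ : Fan N) : torus N k ⊗ toricVariety k Δ ⟶ toricVariety k Δ :=
  glueProd (T := torus N k) (X := toricVariety k Δ) (𝒰 := chartCover k Δ)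
    (fun σ => (torus N k ◁ (coverToChart k Δ σ).hom) ≫ affineAction k _ ≫ chart k Δ σ)
    (chartAction_compatible k Δ)

/-- The torus action is given on charts by the coactions. -/
lemma chart_torusAction (Δ : Fan N) (σ : {σ // σ ∈ Δ.cones}) :
    (torus N k ◁ chart k Δ σ) ≫ torusAction k Δ = affineAction k σ.1 ≫ chart k Δ σ := by
  rw [← cancel_epi (torus N k ◁ (coverToChart k Δ σ).hom),
    ← MonoidalCategory.whiskerLeft_comp_assoc, coverToChart_chart]
  exact whisker_glueProd (T := torus N k) (X := toricVariety k Δ) (𝒰 := chartCover k Δ)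
    (fun σ => (torus N k ◁ (coverToChart k Δ σ).hom) ≫ affineAction k _ ≫ chart k Δ σ)
    (chartAction_compatible k Δ) σ

/-- If `m` vanishes on `σ` then it vanishes on the lattice of `σ`. -/
lemma latticeOf_le_ker {σ : RealCone N} {m : Module.Dual ℤ N} (hm : ∀ x ∈ σ, pairing m x = 0) :
    latticeOf σ ≤ LinearMap.ker m := by
  intro n hn
  have h : Submodule.span ℝ (σ : Set (RealSpace N)) ≤ LinearMap.ker (pairing m) :=
    Submodule.span_le.2 fun x hx => hm x hx
  have h' : pairing m (latticeIncl N n) = 0 := h hn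
  rw [pairing_latticeIncl] at h'
  exact_mod_cast h'

open Classical in
/-- The restriction of functions from `U_σ` to its torus orbit of smallest dimension, which is the
torus with cocharacter lattice `N / N_σ`: it takes `χ^m` to `χ^m` if `m` vanishes on `σ`, and to
zero otherwise. -/
def orbitHom (σ : RealCone N) :
    coordRing k σ →ₐ[k] AddMonoidAlgebra k (Module.Dual ℤ (N ⧸ latticeOf σ)) :=
  AddMonoidAlgebra.lift k _ (dualMonoid σ)
    { toFun := fun m =>
        if h : ∀ x ∈ σ, pairing m.toAdd.1 x = 0 then
          AddMonoidAlgebra.single ((latticeOf σ).liftQ m.toAdd.1 (latticeOf_le_ker h)) 1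
        else 0
      map_one' := by
        have h : ∀ x ∈ σ, pairing (Multiplicative.toAdd (1 : Multiplicative (dualMonoid σ))).1 x =
            0 := by
          intro x _; simp [pairing]
        rw [dif_pos h, AddMonoidAlgebra.one_def]
        congr 1
        ext n
        simp
      map_mul' := by
        intro a b
        have key : (∀ x ∈ σ, pairing (Multiplicative.toAdd (a * b)).1 x = 0) ↔
            (∀ x ∈ σ, pairing a.toAdd.1 x = 0) ∧ (∀ x ∈ σ, pairing b.toAdd.1 x = 0) := by
          have e : ∀ x, pairing (Multiplicative.toAdd (a * b)).1 x =
              pairing a.toAdd.1 x + pairing b.toAdd.1 x := fun x => pairing_add _ _ x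
          constructor
          · intro h
            refine ⟨fun x hx => ?_, fun x hx => ?_⟩ <;>
            · have h₁ := a.toAdd.2 x hx
              have h₂ := b.toAdd.2 x hx
              have h₃ := h x hx
              rw [e] at h₃
              linarith
          · rintro ⟨h₁, h₂⟩ x hx
            rw [e, h₁ x hx, h₂ x hx, add_zero]
        by_cases ha : ∀ x ∈ σ, pairing a.toAdd.1 x = 0
        · by_cases hb : ∀ x ∈ σ, pairing b.toAdd.1 x = 0
          · rw [dif_pos (key.2 ⟨ha, hb⟩), dif_pos ha, dif_pos hb,
              AddMonoidAlgebra.single_mul_single, mul_one]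
            congr 1
            ext n
            simp
          · rw [dif_neg (fun h => hb (key.1 h).2), dif_neg hb, mul_zero]
        · rw [dif_neg (fun h => ha (key.1 h).1), dif_neg ha, zero_mul] }

/-- The distinguished point of `U_σ`, at which `χ^m` has value `1` if `m` vanishes on `σ` and `0`
otherwise. If `σ` is full-dimensional, it is the torus-fixed point `0 ∈ U_σ`. -/
def distinguishedPoint (σ : RealCone N) : affine k k ⟶ affineToric k σ :=
  affineMap k ((Bialgebra.counitAlgHom k _).comp (orbitHom k σ))

/-- The torus orbit, with cocharacter lattice `N / N_σ`, of a cone `σ` of a fan. -/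
def orbit (Δ : Fan N) (σ : {σ // σ ∈ Δ.cones}) :
    torus (N ⧸ latticeOf σ.1) k ⟶ toricVariety k Δ :=
  affineMap k (orbitHom k σ.1) ≫ chart k Δ σ

/-- The toric stratum of a cone of a fan: the scheme-theoretic closure of its torus orbit. -/
def orbitClosure (Δ : Fan N) (σ : {σ // σ ∈ Δ.cones}) : Over (Spec (CommRingCat.of k)) :=
  Over.mk ((orbit k Δ σ).left.imageι ≫ (toricVariety k Δ).hom)

/-- The closed embedding of a toric stratum. -/
def orbitClosureIncl (Δ : Fan N) (σ : {σ // σ ∈ Δ.cones}) :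
    orbitClosure k Δ σ ⟶ toricVariety k Δ :=
  Over.homMk (orbit k Δ σ).left.imageι rfl

/-- The embedding of a torus orbit in its closure. -/
def orbitToClosure (Δ : Fan N) (σ : {σ // σ ∈ Δ.cones}) :
    torus (N ⧸ latticeOf σ.1) k ⟶ orbitClosure k Δ σ :=
  Over.homMk (orbit k Δ σ).left.toImage (by
    refine (Category.assoc _ _ _).symm.trans ?_
    exact (congrArg (· ≫ (toricVariety k Δ).hom)
      (Scheme.Hom.toImage_imageι (orbit k Δ σ).left)).trans (Over.w (orbit k Δ σ)))

lemma pairing_realMap (f : N →ₗ[ℤ] N') (m : Module.Dual ℤ N') (x : RealSpace N) :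
    pairing m (realMap f x) = pairing (m.comp f) x := by
  induction x using TensorProduct.induction_on with
  | zero => simp
  | add x y hx hy => rw [map_add, map_add, map_add, hx, hy]
  | tmul r n => simp [pairing, realMap]

/-- The homomorphism `χ^m ↦ χ^{m ∘ f}` for a homomorphism of lattices `f` mapping `σ` to `σ'`. -/
def pullbackHom (f : N →ₗ[ℤ] N') {σ : RealCone N} {σ' : RealCone N'} (h : σ.map (realMap f) ≤ σ') :
    coordRing k σ' →ₐ[k] coordRing k σ :=
  AddMonoidAlgebra.mapDomainAlgHom k k
    { toFun := fun m => (⟨m.1.comp f, fun x hx => by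
        rw [← pairing_realMap]
        exact m.2 _ (h ⟨x, hx, rfl⟩)⟩ : dualMonoid σ)
      map_zero' := rfl
      map_add' := fun _ _ => rfl }

/-- The toric morphism from the toric variety of a fan to `U_σ'`, for a homomorphism of lattices
mapping all cones of the fan to `σ'`. -/
def toricMap (f : N →ₗ[ℤ] N') (Δ : Fan N) (σ' : RealCone N')
    (h : ∀ σ ∈ Δ.cones, σ.map (realMap f) ≤ σ') : toricVariety k Δ ⟶ affineToric k σ' :=
  Over.homMk (colimit.desc (chartFunctor k Δ)
    { pt := (affineToric k σ').left
      ι := { app := fun σ => (affineMap k (pullbackHom k f (h σ.1 σ.2))).left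
             naturality := by
              intro σ₁ σ₂ g
              refine Eq.trans ?_ (Category.comp_id _).symm
              have e : (restrictHom k (leOfHom g)).comp (pullbackHom k f (h σ₂.1 σ₂.2)) =
                  pullbackHom k f (h σ₁.1 σ₁.2) := by
                refine AddMonoidAlgebra.algHom_ext (fun m => ?_) (by ext)
                simp [restrictHom, pullbackHom]
                rfl
              exact congrArg (fun a => Over.Hom.left a)
                ((affineMap_comp k _ _).trans (congrArg (affineMap k) e)) } })
    (by
      refine colimit.hom_ext fun σ => ?_
      refine (colimit.ι_desc_assoc _ _ _).trans ?_
      refine (Over.w (affineMap k (pullbackHom k f (h σ.1 σ.2)))).trans ?_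
      exact (Over.w (chart k Δ σ)).symm)

end Charts

/-! ### Tropical expansions -/

section Expansion

variable {N L : Type u} [AddCommGroup N] [AddCommGroup L]

variable (L) in
/-- Strictly convex rational polyhedral cones spanning `L ⊗ ℝ`, as bases of expansions. -/
structure BaseCone where
  cone : RealCone L
  rational : IsRationalPolyhedral cone
  strictlyConvex : IsStrictlyConvex cone
  fullDimensional : IsFullDimensional cone

variable (N L) in
/-- The map `r`, the projection to the space of `Σ`. -/
abbrev projTarget : RealSpace (N × L) →ₗ[ℝ] RealSpace N := realMap (LinearMap.fst ℤ N L)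

variable (N L) in
/-- The map `p`, the projection to the space of `τ`. -/
abbrev projBase : RealSpace (N × L) →ₗ[ℝ] RealSpace L := realMap (LinearMap.snd ℤ N L)

/-- A tropical expansion of a fan `Σ` over a cone `τ`: a subdivision of `Σ × τ`, whose support need
not be all of `|Σ × τ|`, such that the projection `p` to `τ` maps each cone onto a face of `τ` and
its lattice onto the lattice of that face. The cones of `Υ` carry the lattices induced from
`N_Σ × N_τ`. -/
structure TropicalExpansion (Sig : Fan N) (τ : BaseCone L) where
  fan : Fan (N × L)
  subdivision : ∀ ω ∈ fan.cones, ∃ σ ∈ Sig.cones,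
    ω.map (projTarget N L) ≤ σ ∧ ω.map (projBase N L) ≤ τ.cone
  integral : ∀ ω ∈ fan.cones, IsFace (ω.map (projBase N L)) τ.cone
  saturated : ∀ ω ∈ fan.cones,
    (latticeOf ω).map (LinearMap.snd ℤ N L) = latticeOf (ω.map (projBase N L))

namespace TropicalExpansion

variable {Sig : Fan N} {τ : BaseCone L} (Υ : TropicalExpansion Sig τ)

/-- The vertices of the polyhedral subdivisions `p⁻¹(f)`, for `f` in the interior of `τ`, are the
cones of `Υ` that `p` maps isomorphically to `τ`. -/
structure Vertex where
  cone : RealCone (N × L)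
  mem : cone ∈ Υ.fan.cones
  bijOn : Set.BijOn (projBase N L) (cone : Set (RealSpace (N × L))) (τ.cone : Set (RealSpace L))

variable (k : Type u) [Field k]

/-- The logarithmic expansion `X_Υ`. -/
abbrev total : Over (Spec (CommRingCat.of k)) := toricVariety k Υ.fan

/-- The morphism `π : X_Υ ⟶ U_τ`. -/
def toBase : Υ.total k ⟶ affineToric k τ.cone :=
  toricMap k (LinearMap.snd ℤ N L) Υ.fan τ.cone fun ω hω => (Υ.integral ω hω).le

/-- The central fibre `Y_Υ`, the fibre of `X_Υ ⟶ U_τ` over `0 ∈ U_τ`. -/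
def centralFibre : Scheme.{u} :=
  pullback (Υ.toBase k).left (distinguishedPoint k τ.cone).left

/-- The inclusion of the central fibre. -/
def centralFibreIncl : Υ.centralFibre k ⟶ (Υ.total k).left := pullback.fst _ _

/-- The rubber action of `T_τ` on `X_Υ`, induced by the inclusion of `T_τ` as a factor of the
dense torus `T_Σ × T_τ` of `X_Υ`. -/
def rubberAction : torus L k ⊗ Υ.total k ⟶ Υ.total k :=
  (torusMap k (LinearMap.inr ℤ N L) ▷ Υ.total k) ≫ torusAction k Υ.fan

namespace Vertex

variable {Υ} (v : Υ.Vertex)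

/-- The component `Y_v` of the central fibre: the stratum of `X_Υ` given by the cone of `v`. -/
abbrev component : Over (Spec (CommRingCat.of k)) := orbitClosure k Υ.fan ⟨v.cone, v.mem⟩

/-- The embedding of `Y_v` in `X_Υ`. -/
abbrev componentIncl : v.component k ⟶ Υ.total k := orbitClosureIncl k Υ.fan ⟨v.cone, v.mem⟩

/-- The cocharacter lattice `N_v = (N_Σ × N_τ) / N_{ω_v}`. -/
abbrev lattice : Type u := (N × L) ⧸ latticeOf v.cone

/-- The torus `T_v` in `Y_v`. -/
abbrev denseTorus : Over (Spec (CommRingCat.of k)) := torus v.lattice k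

/-- The embedding `T_v ⟶ Y_v`. -/
abbrev torusIncl : v.denseTorus k ⟶ v.component k := orbitToClosure k Υ.fan ⟨v.cone, v.mem⟩

/-- The minimal cone `σ_v` of `Σ` containing the vertex `v`. -/
def minimalCone : RealCone N := sInf {σ | σ ∈ Sig.cones ∧ v.cone.map (projTarget N L) ≤ σ}

lemma isLeast_minimalCone :
    IsLeast {σ | σ ∈ Sig.cones ∧ v.cone.map (projTarget N L) ≤ σ} v.minimalCone := by
  refine ⟨?_, fun σ hσ => sInf_le hσ⟩
  have hfin : {σ | σ ∈ Sig.cones ∧ v.cone.map (projTarget N L) ≤ σ}.Finite :=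
    Sig.finite.subset fun σ hσ => hσ.1
  have hne : {σ | σ ∈ Sig.cones ∧ v.cone.map (projTarget N L) ≤ σ}.Nonempty := by
    obtain ⟨σ, hσ, h, -⟩ := Υ.subdivision v.cone v.mem
    exact ⟨σ, hσ, h⟩
  refine ⟨?_, le_sInf fun σ hσ => hσ.2⟩
  have key : ∀ s : Set (RealCone N), s.Finite → s.Nonempty → (∀ σ ∈ s, σ ∈ Sig.cones) →
      sInf s ∈ Sig.cones := by
    intro s hs
    refine Set.Finite.induction_on (motive := fun s _ => s.Nonempty →
      (∀ σ ∈ s, σ ∈ Sig.cones) → sInf s ∈ Sig.cones) s hs (fun h => by simp at h) ?_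
    intro a s _ _ ih _ hmem
    rw [sInf_insert]
    rcases s.eq_empty_or_nonempty with rfl | hne
    · simpa using hmem a (by simp)
    · exact Sig.inf_mem (hmem a (by simp)) (ih hne fun σ hσ => hmem σ (by simp [hσ]))
  exact key _ hfin hne fun σ hσ => hσ.1

lemma map_cone : v.cone.map (projBase N L) = τ.cone :=
  SetLike.coe_injective (by rw [PointedCone.coe_map]; exact v.bijOn.image_eq)

lemma bijective_projBase [Module.Free ℤ N] [Module.Free ℤ L] :
    Function.Bijective ((LinearMap.snd ℤ N L).domRestrict (latticeOf v.cone)) := by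
  constructor
  · rw [← LinearMap.ker_eq_bot, LinearMap.ker_eq_bot']
    intro n hn
    have hn' : n.1.2 = 0 := hn
    have h₁ : projBase N L (latticeIncl (N × L) n.1) = 0 := by
      rw [realMap_latticeIncl]
      exact (congrArg (latticeIncl L) hn').trans (map_zero _)
    obtain ⟨a, ha, b, hb, hab⟩ := mem_span_cone n.2
    have h₂ : projBase N L a = projBase N L b := by
      rw [hab, map_sub, sub_eq_zero] at h₁
      exact h₁
    have h₃ : a = b := v.bijOn.injOn ha hb h₂
    rw [h₃, sub_self] at hab
    exact Subtype.ext (latticeIncl_injective (hab.trans (map_zero _).symm))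
  · intro l
    have hl : l ∈ latticeOf τ.cone := by
      change latticeIncl L l ∈ Submodule.span ℝ (τ.cone : Set (RealSpace L))
      rw [τ.fullDimensional]
      trivial
    rw [← v.map_cone, ← Υ.saturated v.cone v.mem] at hl
    obtain ⟨n, hn, rfl⟩ := hl
    exact ⟨⟨n, hn⟩, rfl⟩

lemma fst_mem (n : latticeOf v.cone) : n.1.1 ∈ latticeOf v.minimalCone := by
  obtain ⟨a, ha, b, hb, hab⟩ := mem_span_cone n.2
  change latticeIncl N (LinearMap.fst ℤ N L n.1) ∈
    Submodule.span ℝ (v.minimalCone : Set (RealSpace N))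
  rw [← realMap_latticeIncl, hab, map_sub]
  exact sub_mem (Submodule.subset_span (v.isLeast_minimalCone.1.2 ⟨a, ha, rfl⟩))
    (Submodule.subset_span (v.isLeast_minimalCone.1.2 ⟨b, hb, rfl⟩))

variable [Module.Free ℤ N] [Module.Free ℤ L]

/-- The tropical position map `φ_v : τ → σ_v` on lattices: the inverse of the isomorphism
`p : N_{ω_v} → N_τ` followed by `r : N_{ω_v} → N_{σ_v}`. -/
def positionMap : L →ₗ[ℤ] latticeOf v.minimalCone :=
  (((LinearMap.fst ℤ N L).domRestrict (latticeOf v.cone)).codRestrict (latticeOf v.minimalCone)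
    v.fst_mem).comp (LinearEquiv.ofBijective _ v.bijective_projBase).symm.toLinearMap

lemma positionMap_snd (n : latticeOf v.cone) : (v.positionMap n.1.2 : N) = n.1.1 := by
  have h : (LinearEquiv.ofBijective _ v.bijective_projBase).symm n.1.2 = n :=
    (LinearEquiv.ofBijective _ v.bijective_projBase).symm_apply_apply n
  exact congrArg (fun a : latticeOf v.cone => a.1.1) h

/-- The position map takes `f ∈ τ` to the image under `r` of the point of `ω_v` over `f`. -/
lemma positionMap_spec (x : RealSpace (N × L)) (hx : x ∈ v.cone) :
    realMap ((latticeOf v.minimalCone).subtype ∘ₗ v.positionMap) (projBase N L x) =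
      projTarget N L x := by
  obtain ⟨s, hs⟩ := Υ.fan.rational v.cone v.mem
  rw [hs] at hx
  have hmem : ∀ n ∈ s, n ∈ latticeOf v.cone := by
    intro n hn
    refine Submodule.subset_span ?_
    rw [hs]
    exact PointedCone.subset_hull ⟨n, hn, rfl⟩
  have hle : PointedCone.hull ℝ (latticeIncl (N × L) '' s) ≤ PointedCone.ofSubmodule
      (LinearMap.eqLocus (realMap ((latticeOf v.minimalCone).subtype ∘ₗ v.positionMap) ∘ₗ
        projBase N L) (projTarget N L)) := by
    refine Submodule.span_le.2 ?_
    rintro _ ⟨n, hn, rfl⟩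
    rw [SetLike.mem_coe, PointedCone.mem_ofSubmodule_iff, LinearMap.mem_eqLocus,
      LinearMap.comp_apply, realMap_latticeIncl, realMap_latticeIncl, realMap_latticeIncl]
    exact congrArg _ (v.positionMap_snd ⟨n, hmem n hn⟩)
  exact hle hx

end Vertex
end TropicalExpansion
end Expansion
end
end Toric

open Toric

/-! On lattices the theorem is a statement about a graph. Since `p` maps `N_{ω_v}` isomorphically
onto `N_τ`, the lattice `N_{ω_v}` is the graph of `φ_v`, so modulo it `(g, h)` is congruent to `(g -
φ_v(h), 0)`. Hence `ι` must send `x` to the class of `(-x, 0)`, and the composite `N_τ → N_Σ × N_τ →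
N_v` is `ι ∘ φ_v` (`mkQ_comp_inr`). As `N_{σ_v}` is saturated, it is a direct summand of `N_Σ`. This
yields a left inverse of `ι`, so `ι` is injective and `ι ⊗ 𝔾ₘ` is a closed immersion.

The geometric input holds for any cone of any fan (`exists_modObj_orbitClosure`): the big torus acts
on an orbit closure through the quotient torus `T_v`. The quotient of lattices splits, so `T_v` acts
through a section. The action preserves the closure because it preserves the orbit, which is
scheme-theoretically dense and remains so after the flat base change to a product with a torus. The
big torus and its projection to the chosen copy of `T_v` act equally on the orbit, hence, again by
density, on the closure. The target of the density argument has to be affine, so this comparison is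
made on charts, which are stable under the torus. Restriction to `T_τ` along `inr` and the lattice
identity then describe the rubber action.

For the central fibre, a character on the chart of `ω_v` is the pullback of a character of `U_τ`
times one vanishing on `ω_v` (`exists_eq_snd_add`). So over `0` all characters not vanishing on
`ω_v` are zero, and in this chart the fibre is, as a set, the closed orbit `T_v`. An irreducible set
containing `Y_v` meets the chart, so it is the closure of its part there and lies in `Y_v`. -/

noncomputable section

namespace Toric

/-! ### Saturation of the lattice of a cone and splitting of the quotient -/

section Lattices

variable {N : Type u} [AddCommGroup N]

/-- A real span is closed under division by nonzero integers. This saturation makes the quotient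
lattice torsion-free, hence free when `N` is finitely generated, and all the splittings below rest
on it. -/
lemma mem_latticeOf_of_smul_mem {σ : RealCone N} {n : ℤ} (hn : n ≠ 0) {x : N}
    (h : n • x ∈ latticeOf σ) : x ∈ latticeOf σ := by
  change latticeIncl N (n • x) ∈ Submodule.span ℝ (σ : Set (RealSpace N)) at h
  change latticeIncl N x ∈ Submodule.span ℝ (σ : Set (RealSpace N))
  rw [map_zsmul, ← Int.cast_smul_eq_zsmul ℝ] at h
  exact (Submodule.smul_mem_iff _ (Int.cast_ne_zero.2 hn)).1 h

instance (σ : RealCone N) : Module.IsTorsionFree ℤ (N ⧸ latticeOf σ) := by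
  refine Module.IsTorsionFree.of_smul_eq_zero ?_
  intro n x hx
  obtain ⟨x, rfl⟩ := Submodule.Quotient.mk_surjective _ x
  rw [← Submodule.Quotient.mk_smul, Submodule.Quotient.mk_eq_zero] at hx
  rw [Submodule.Quotient.mk_eq_zero]
  exact or_iff_not_imp_left.2 fun hn => mem_latticeOf_of_smul_mem hn hx

variable [Module.Finite ℤ N]

/-- The quotient by the lattice of a cone splits. -/
lemma exists_section_mkQ (σ : RealCone N) :
    ∃ s : N ⧸ latticeOf σ →ₗ[ℤ] N, (latticeOf σ).mkQ ∘ₗ s = LinearMap.id :=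
  Module.projective_lifting_property _ _ (Submodule.mkQ_surjective _)

/-- The lattice of a cone is a direct summand. -/
lemma exists_retraction_latticeOf (σ : RealCone N) :
    ∃ r : N →ₗ[ℤ] latticeOf σ, ∀ x : latticeOf σ, r x = x := by
  obtain ⟨s, hs⟩ := exists_section_mkQ σ
  have h : ∀ x, (LinearMap.id - s ∘ₗ (latticeOf σ).mkQ : N →ₗ[ℤ] N) x ∈ latticeOf σ := by
    intro x
    rw [← Submodule.Quotient.mk_eq_zero]
    simpa [sub_eq_zero] using (LinearMap.congr_fun hs ((latticeOf σ).mkQ x)).symm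
  refine ⟨LinearMap.codRestrict _ _ h, fun x => Subtype.ext ?_⟩
  simp [(Submodule.Quotient.mk_eq_zero _).2 x.2]

end Lattices

/-! ### The lattice of `ω_v` as the graph of `φ_v`, and the embedding `ι` -/

namespace TropicalExpansion.Vertex

variable {N L : Type u} [AddCommGroup N] [AddCommGroup L] {Sig : Fan N} {τ : BaseCone L}
  {Υ : TropicalExpansion Sig τ} (v : Υ.Vertex)
variable [Module.Free ℤ N] [Module.Free ℤ L]

/-- One half of the identification of `N_{ω_v}` with the graph of `φ_v`; the other half is
`positionMap_snd`. -/
lemma positionMap_graph_mem (h : L) : ((v.positionMap h : N), h) ∈ latticeOf v.cone := by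
  obtain ⟨n, rfl⟩ := v.bijective_projBase.2 h
  have : ((v.positionMap n.1.2 : N), n.1.2) = n.1 := Prod.ext (v.positionMap_snd n) rfl
  exact this ▸ n.2

/-- The homomorphism `N_{σ_v} → N_v` sending `g` to the class of `(-g, 0)`. -/
def latticeEmbedding : latticeOf v.minimalCone →ₗ[ℤ] v.lattice :=
  -((latticeOf v.cone).mkQ ∘ₗ LinearMap.inl ℤ N L ∘ₗ (latticeOf v.minimalCone).subtype)

/-- The representatives `(g, h)` and `(g - φ_v(h), 0)` differ by the point `(φ_v(h), h)` of the
graph. -/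
lemma latticeEmbedding_positionMap_sub (g : latticeOf v.minimalCone) (h : L) :
    v.latticeEmbedding (v.positionMap h - g) = Submodule.Quotient.mk ((g : N), h) := by
  have e : v.latticeEmbedding (v.positionMap h - g) =
      Submodule.Quotient.mk (-((v.positionMap h : N) - g), (0 : L)) := by
    simp [latticeEmbedding, ← Submodule.Quotient.mk_neg]
  rw [e, eq_comm, Submodule.Quotient.eq]
  simpa using v.positionMap_graph_mem h

/-- The case `g = 0` of the formula for `ι`. It is the lattice form of the factorization of the
rubber action. -/
lemma mkQ_comp_inr :
    (latticeOf v.cone).mkQ ∘ₗ LinearMap.inr ℤ N L = v.latticeEmbedding ∘ₗ v.positionMap := by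
  refine LinearMap.ext fun h => ?_
  have := v.latticeEmbedding_positionMap_sub 0 h
  rw [sub_zero] at this
  exact this.symm

variable [Module.Finite ℤ N]

lemma exists_leftInverse_latticeEmbedding :
    ∃ r : v.lattice →ₗ[ℤ] latticeOf v.minimalCone, r ∘ₗ v.latticeEmbedding = LinearMap.id := by
  obtain ⟨r, hr⟩ := exists_retraction_latticeOf v.minimalCone
  -- The left inverse is `(g, h) ↦ φ_v(h) - r(g)` for a retraction `r` onto `N_{σ_v}`. It kills the
  -- graph because `r` fixes the values of `φ_v`, and the minus sign matches `ι(x) = [(-x, 0)]`.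
  refine ⟨(latticeOf v.cone).liftQ
    (v.positionMap ∘ₗ LinearMap.snd ℤ N L - r ∘ₗ LinearMap.fst ℤ N L) ?_, ?_⟩
  · intro n hn
    have h := v.positionMap_snd ⟨n, hn⟩
    rw [LinearMap.mem_ker]
    change v.positionMap n.2 - r n.1 = 0
    rw [sub_eq_zero, ← hr (v.positionMap n.2)]
    exact congrArg r h
  · ext g
    simp [latticeEmbedding, hr]

end TropicalExpansion.Vertex

/-! ### Tori, the monoid scheme `U_σ` and its closed orbit -/

section Affine

variable {N N' N'' : Type u} [AddCommGroup N] [AddCommGroup N'] [AddCommGroup N'']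
variable (k : Type u) [Field k]

/-- Induced maps of monoid algebras are bialgebra homomorphisms, and `Spec` turns these into
homomorphisms of monoid schemes. Monoids rather than groups are allowed so that the result covers
the map from the torus to `U_σ`. -/
lemma isMonHom_affineMap_mapDomain {M M' : Type u} [AddCommMonoid M] [AddCommMonoid M']
    (f : M →+ M') : IsMonHom (affineMap k (AddMonoidAlgebra.mapDomainAlgHom k k f)) :=
  ((bialgSpec (.of k)).map
    (Opposite.op (CommBialgCat.ofHom (AddMonoidAlgebra.mapDomainBialgHom k f)))).isMonHom_hom

instance isMonHom_torusMap (f : N →ₗ[ℤ] N') : IsMonHom (torusMap k f) :=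
  isMonHom_affineMap_mapDomain k _

lemma torusMap_comp (f : N →ₗ[ℤ] N') (g : N' →ₗ[ℤ] N'') :
    torusMap k f ≫ torusMap k g = torusMap k (g ∘ₗ f) := by
  refine (affineMap_comp k _ _).trans (congrArg (affineMap k) ?_)
  refine AddMonoidAlgebra.algHom_ext (fun m => ?_) (by ext)
  simp
  rfl

lemma torusMap_id : torusMap k (LinearMap.id : N →ₗ[ℤ] N) = 𝟙 _ := by
  have : AddMonoidAlgebra.mapDomainAlgHom k k
    (LinearMap.id : N →ₗ[ℤ] N).dualMap.toAddMonoidHom = AlgHom.id k _ := by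
    refine AddMonoidAlgebra.algHom_ext (fun m => ?_) (by ext)
    simp
  refine (congrArg (affineMap k) this).trans ?_
  exact Over.OverMorphism.ext (by exact Spec.map_id _)

lemma isClosedImmersion_affineMap {A B : Type u} [CommRing A] [CommRing B] [Algebra k A]
    [Algebra k B] (f : A →ₐ[k] B) (hf : Function.Surjective f) :
    IsClosedImmersion (affineMap k f).left :=
  IsClosedImmersion.spec_of_surjective _ hf

lemma mapDomainAlgHom_surjective {M M' : Type u} [AddCommMonoid M] [AddCommMonoid M']
    {f : M →+ M'} (hf : Function.Surjective f) :
    Function.Surjective (AddMonoidAlgebra.mapDomainAlgHom k k f) := by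
  intro x
  induction x using AddMonoidAlgebra.induction_linear with
  | zero => exact ⟨0, map_zero _⟩
  | add _ _ ha hb =>
    obtain ⟨a, rfl⟩ := ha
    obtain ⟨b, rfl⟩ := hb
    exact ⟨a + b, map_add _ _ _⟩
  | single m a =>
    obtain ⟨m, rfl⟩ := hf m
    exact ⟨AddMonoidAlgebra.single m a, by simp⟩

/-- A left inverse extends every character, `m = (m ∘ r) ∘ f`, so the map of coordinate rings is
surjective. Injectivity of `f` would not suffice: multiplication by an integer `n > 1` gives the
`n`-th power map. -/
lemma isClosedImmersion_torusMap (f : N →ₗ[ℤ] N') (r : N' →ₗ[ℤ] N)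
    (h : r ∘ₗ f = LinearMap.id) : IsClosedImmersion (torusMap k f).left := by
  refine isClosedImmersion_affineMap k _ (mapDomainAlgHom_surjective k fun m => ?_)
  refine ⟨m ∘ₗ r, ?_⟩
  change (m ∘ₗ r) ∘ₗ f = m
  rw [LinearMap.comp_assoc, h, LinearMap.comp_id]

/-- The homomorphism of monoid schemes from the torus to `U_σ`. -/
def torusToAffine (σ : RealCone N) : torus N k ⟶ affineToric k σ :=
  affineMap k (AddMonoidAlgebra.mapDomainAlgHom k k (dualMonoid σ).subtype)

instance (σ : RealCone N) : IsMonHom (torusToAffine k σ) :=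
  isMonHom_affineMap_mapDomain k _

lemma affineProd_natural_right {A B C : Type u} [CommRing A] [CommRing B] [CommRing C] [Algebra k A]
    [Algebra k B] [Algebra k C] (f : A →ₐ[k] C) :
    (affineMap k f ▷ affine k B) ≫ (affineProd k A B).hom =
      (affineProd k C B).hom ≫ affineMap k (Algebra.TensorProduct.map f (AlgHom.id k B)) := by
  rw [← cancel_mono (affineProd k A B).inv, Category.assoc, Iso.hom_inv_id, Category.comp_id]
  refine CartesianMonoidalCategory.hom_ext _ _ ?_ ?_
  · rw [CartesianMonoidalCategory.whiskerRight_fst]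
    rw [← affineProd_hom_fst k A B, ← affineProd_hom_fst k C B]
    simp only [Category.assoc, Iso.inv_hom_id_assoc]
    rw [affineMap_comp, affineMap_comp]
    congr 2
  · rw [CartesianMonoidalCategory.whiskerRight_snd]
    rw [← affineProd_hom_snd k A B, ← affineProd_hom_snd k C B]
    simp only [Category.assoc, Iso.inv_hom_id_assoc]
    rw [affineMap_comp]
    congr 2
    ext x
    simp

lemma mul_affine (A : Type u) [CommRing A] [Bialgebra k A] :
    (MonObj.mul : affine k A ⊗ affine k A ⟶ affine k A) =
      (affineProd k A A).hom ≫ affineMap k (Bialgebra.comulAlgHom k A) :=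
  Over.OverMorphism.ext rfl

/-- The action is multiplication in the monoid scheme `U_σ` precomposed with the homomorphism from
the torus. The action axioms thereby reduce to the unit and associativity laws of `U_σ`. -/
lemma affineAction_eq (σ : RealCone N) :
    affineAction k σ = (torusToAffine k σ ▷ affineToric k σ) ≫ MonObj.mul := by
  rw [mul_affine, torusToAffine, ← Category.assoc, affineProd_natural_right, Category.assoc,
    affineMap_comp]
  rfl

lemma one_affineAction (σ : RealCone N) :
    (MonObj.one ▷ affineToric k σ) ≫ affineAction k σ = (λ_ _).hom := by
  rw [affineAction_eq, ← MonoidalCategory.comp_whiskerRight_assoc, IsMonHom.one_hom,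
    MonObj.one_mul]

lemma mul_affineAction (σ : RealCone N) :
    (MonObj.mul ▷ affineToric k σ) ≫ affineAction k σ = (α_ _ _ _).hom ≫
      (torus N k ◁ affineAction k σ) ≫ affineAction k σ := by
  rw [affineAction_eq, ← MonoidalCategory.comp_whiskerRight_assoc, IsMonHom.mul_hom,
    MonoidalCategory.comp_whiskerRight_assoc, MonObj.mul_assoc]
  simp only [MonoidalCategory.tensorHom_def, MonoidalCategory.comp_whiskerRight,
    MonoidalCategory.whiskerLeft_comp, Category.assoc,
    MonoidalCategory.associator_naturality_left_assoc,
    MonoidalCategory.associator_naturality_middle_assoc]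
  rw [MonoidalCategory.whisker_exchange_assoc]
  rw [MonoidalCategory.whisker_exchange_assoc]

lemma orbitHom_single_of_vanishing (σ : RealCone N) (m : dualMonoid σ)
    (h : ∀ x ∈ σ, pairing m.1 x = 0) :
    orbitHom k σ (AddMonoidAlgebra.single m 1) =
      AddMonoidAlgebra.single ((latticeOf σ).liftQ m.1 (latticeOf_le_ker h)) 1 := by
  rw [orbitHom, AddMonoidAlgebra.lift_single, one_smul]
  exact dif_pos h

lemma orbitHom_single_of_not_vanishing (σ : RealCone N) (m : dualMonoid σ)
    (h : ¬ ∀ x ∈ σ, pairing m.1 x = 0) :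
    orbitHom k σ (AddMonoidAlgebra.single m 1) = 0 := by
  rw [orbitHom, AddMonoidAlgebra.lift_single, one_smul]
  exact dif_neg h

/-- Converse of `latticeOf_le_ker`. Rationality enters because the cone must be generated by its
lattice points. -/
lemma pairing_eq_zero_of_latticeOf_le_ker {σ : RealCone N} (hσ : IsRationalPolyhedral σ)
    {m : Module.Dual ℤ N} (hm : latticeOf σ ≤ LinearMap.ker m) : ∀ x ∈ σ, pairing m x = 0 := by
  obtain ⟨s, rfl⟩ := hσ
  have hle : PointedCone.hull ℝ (latticeIncl N '' s) ≤
      PointedCone.ofSubmodule (LinearMap.ker (pairing m)) := by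
    refine Submodule.span_le.2 ?_
    rintro _ ⟨n, hn, rfl⟩
    rw [SetLike.mem_coe, PointedCone.mem_ofSubmodule_iff, LinearMap.mem_ker, pairing_latticeIncl]
    have : n ∈ LinearMap.ker m :=
      hm (Submodule.subset_span (PointedCone.subset_hull ⟨n, hn, rfl⟩))
    exact_mod_cast LinearMap.mem_ker.1 this
  exact fun x hx => hle hx

/-- The inclusion of the functions on the closed orbit of `U_σ` into the functions on `U_σ`, as
the span of the characters that vanish on `σ`. -/
def orbitSection {σ : RealCone N} (hσ : IsRationalPolyhedral σ) :
    AddMonoidAlgebra k (Module.Dual ℤ (N ⧸ latticeOf σ)) →ₐ[k] coordRing k σ :=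
  AddMonoidAlgebra.mapDomainAlgHom k k
    { toFun := fun m => (⟨m ∘ₗ (latticeOf σ).mkQ, fun x hx =>
        (pairing_eq_zero_of_latticeOf_le_ker hσ (m := m ∘ₗ (latticeOf σ).mkQ) (fun n hn => by
          simp [(Submodule.Quotient.mk_eq_zero _).2 hn]) x hx).ge⟩ : dualMonoid σ)
      map_zero' := rfl
      map_add' := fun _ _ => rfl }

lemma orbitSection_orbitHom_single {σ : RealCone N} (hσ : IsRationalPolyhedral σ)
    (m : dualMonoid σ) (h : ∀ x ∈ σ, pairing m.1 x = 0) :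
    orbitSection k hσ (orbitHom k σ (AddMonoidAlgebra.single m 1)) =
      AddMonoidAlgebra.single m 1 := by
  rw [orbitHom_single_of_vanishing k σ m h, orbitSection, AddMonoidAlgebra.mapDomainAlgHom_apply,
    AddMonoidAlgebra.mapDomain_single]
  rfl

lemma orbitHom_comp_orbitSection {σ : RealCone N} (hσ : IsRationalPolyhedral σ) :
    (orbitHom k σ).comp (orbitSection k hσ) = AlgHom.id k _ := by
  refine AddMonoidAlgebra.algHom_ext (fun m => ?_) (by ext)
  rw [AlgHom.comp_apply, orbitSection, AddMonoidAlgebra.mapDomainAlgHom_apply,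
    AddMonoidAlgebra.mapDomain_single, orbitHom_single_of_vanishing]
  · rw [AlgHom.id_apply]
    congr 1
    exact Submodule.linearMap_qext _ (Submodule.liftQ_mkQ _ _ _)
  · exact pairing_eq_zero_of_latticeOf_le_ker hσ (m := m ∘ₗ (latticeOf σ).mkQ) fun n hn => by
      simp [(Submodule.Quotient.mk_eq_zero _).2 hn]

/-- Because `orbitSection` is a right inverse. Geometrically, the smallest orbit is closed in `U_σ`.
-/
lemma orbitHom_surjective {σ : RealCone N} (hσ : IsRationalPolyhedral σ) :
    Function.Surjective (orbitHom k σ) := fun x =>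
  ⟨orbitSection k hσ x, DFunLike.congr_fun (orbitHom_comp_orbitSection k hσ) x⟩

/-- The torus acts on the closed orbit of `U_σ` through the quotient torus. -/
lemma orbitHom_affineAction (σ : RealCone N) :
    (torus N k ◁ affineMap k (orbitHom k σ)) ≫ affineAction k σ =
      (torusMap k (latticeOf σ).mkQ ▷ torus (N ⧸ latticeOf σ) k) ≫ MonObj.mul ≫
        affineMap k (orbitHom k σ) := by
  rw [mul_affine, affineAction, ← Category.assoc, affineProd_natural, torusMap,
    Category.assoc, affineMap_comp, Category.assoc, affineMap_comp, ← Category.assoc,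
    affineProd_natural_right, Category.assoc, affineMap_comp]
  congr 2
  refine AddMonoidAlgebra.algHom_ext (fun m => ?_) (by ext)
  rw [AlgHom.comp_apply, AlgHom.comp_apply, AlgHom.comp_apply, coaction_single,
    Algebra.TensorProduct.map_tmul]
  -- A character that vanishes on `σ` descends to the quotient torus and is group-like there; any
  -- other character becomes zero on both sides.
  by_cases h : ∀ x ∈ σ, pairing m.1 x = 0
  · rw [orbitHom_single_of_vanishing k σ m h]
    simp
    rfl
  · rw [orbitHom_single_of_not_vanishing k σ m h]
    simp

end Affine

/-! ### From charts to the whole toric variety: axioms of the torus action -/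

section Covers

variable {S : Scheme.{u}} {T X Z : Over S}

lemma whiskerLeft_cover_hom_ext (𝒰 : X.left.OpenCover) {f g : T ⊗ X ⟶ Z}
    (h : ∀ i, (T ◁ coverIncl X 𝒰 i) ≫ f = (T ◁ coverIncl X 𝒰 i) ≫ g) : f = g := by
  refine Over.OverMorphism.ext (Scheme.Cover.hom_ext (prodCover T X 𝒰) _ _ fun i => ?_)
  have e : (prodCover T X 𝒰).f i = coverProdMap T X 𝒰 i ≫ (T ◁ coverIncl X 𝒰 i).left :=
    (coverProdMap_whisker T X 𝒰 i).symm
  rw [e]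
  refine (Category.assoc _ _ _).trans (Eq.trans ?_ (Category.assoc _ _ _).symm)
  exact congrArg (coverProdMap T X 𝒰 i ≫ ·) (congrArg (fun a => Over.Hom.left a) (h i))

end Covers

section Action

variable {N : Type u} [AddCommGroup N] (k : Type u) [Field k] (Δ : Fan N)

/-- The products of `T` with the charts cover the product, so the axioms of the glued action follow
from those on the `U_σ`. -/
lemma whiskerLeft_chart_hom_ext {T Z : Over (Spec (CommRingCat.of k))}
    {f g : T ⊗ toricVariety k Δ ⟶ Z}
    (h : ∀ σ, (T ◁ chart k Δ σ) ≫ f = (T ◁ chart k Δ σ) ≫ g) : f = g := by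
  refine whiskerLeft_cover_hom_ext (chartCover k Δ) fun σ => ?_
  have e := coverToChart_chart k Δ σ
  refine (congrArg (fun a => (T ◁ a) ≫ f) e.symm).trans
    (Eq.trans ?_ (congrArg (fun a => (T ◁ a) ≫ g) e))
  rw [MonoidalCategory.whiskerLeft_comp_assoc, MonoidalCategory.whiskerLeft_comp_assoc]
  exact congrArg ((T ◁ (coverToChart k Δ σ).hom) ≫ ·) (h σ)

lemma one_torusAction :
    (MonObj.one ▷ toricVariety k Δ) ≫ torusAction k Δ = (λ_ (toricVariety k Δ)).hom := by
  refine whiskerLeft_chart_hom_ext k Δ fun σ => ?_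
  rw [MonoidalCategory.whisker_exchange_assoc, chart_torusAction, ← Category.assoc,
    one_affineAction, MonoidalCategory.leftUnitor_naturality]

lemma mul_torusAction :
    (MonObj.mul ▷ toricVariety k Δ) ≫ torusAction k Δ =
      (α_ _ _ _).hom ≫ (torus N k ◁ torusAction k Δ) ≫ torusAction k Δ := by
  refine whiskerLeft_chart_hom_ext k Δ fun σ => ?_
  rw [MonoidalCategory.whisker_exchange_assoc, chart_torusAction, ← Category.assoc,
    mul_affineAction, MonoidalCategory.associator_naturality_right_assoc,
    ← MonoidalCategory.whiskerLeft_comp_assoc, chart_torusAction,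
    MonoidalCategory.whiskerLeft_comp_assoc, chart_torusAction]
  simp only [Category.assoc]

/-- The orbit of a cone is equivariant for the quotient map of tori. -/
lemma orbit_torusAction (σ : {σ // σ ∈ Δ.cones}) :
    (torus N k ◁ orbit k Δ σ) ≫ torusAction k Δ =
      (torusMap k (latticeOf σ.1).mkQ ▷ torus (N ⧸ latticeOf σ.1) k) ≫ MonObj.mul ≫
        orbit k Δ σ := by
  rw [orbit, MonoidalCategory.whiskerLeft_comp, Category.assoc, chart_torusAction,
    ← Category.assoc, orbitHom_affineAction, Category.assoc, Category.assoc]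

end Action

/-! ### Scheme-theoretic density -/

section Dominant

lemma ker_comp_of_isSchemeTheoreticallyDominant {X Y Z : Scheme.{u}} (f : X ⟶ Y) (g : Y ⟶ Z)
    [IsSchemeTheoreticallyDominant f] : (f ≫ g).ker = g.ker := by
  rw [Scheme.Hom.ker_comp, f.ker_eq_bot, Scheme.IdealSheafData.map_bot]

/-- A morphism factors through a closed immersion if it does so on a scheme-theoretically dense
part of the source. -/
lemma exists_lift_of_isSchemeTheoreticallyDominant {W Z X Y : Scheme.{u}} (f : W ⟶ Z)
    [IsSchemeTheoreticallyDominant f] (i : Y ⟶ X) [IsClosedImmersion i] (g : Z ⟶ X) (h : W ⟶ Y)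
    (e : f ≫ g = h ≫ i) : ∃ g' : Z ⟶ Y, g' ≫ i = g :=
  ⟨IsClosedImmersion.lift i g (by
    rw [← ker_comp_of_isSchemeTheoreticallyDominant f g, e]
    exact h.le_ker_comp i), IsClosedImmersion.lift_fac _ _ _⟩

/-- The equalizer is a closed subscheme because the affine target is separated. The dense source
maps into it, so it is all of `Z`. -/
lemma hom_ext_of_isSchemeTheoreticallyDominant {W Z U : Scheme.{u}} (f : W ⟶ Z)
    [IsSchemeTheoreticallyDominant f] [IsAffine U] {a b : Z ⟶ U} (h : f ≫ a = f ≫ b) :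
    a = b := by
  have : IsClosedImmersion (equalizer.ι a b) := inferInstance
  obtain ⟨g, hg⟩ := exists_lift_of_isSchemeTheoreticallyDominant f (equalizer.ι a b) (𝟙 Z)
    (equalizer.lift f h) (by simp)
  rw [← Category.id_comp a, ← Category.id_comp b, ← hg, Category.assoc, Category.assoc,
    equalizer.condition]

variable {S : Scheme.{u}}

lemma isPullback_whiskerLeft_left (A : Over S) {X Y : Over S} (f : X ⟶ Y) :
    IsPullback (A ◁ f).left (SemiCartesianMonoidalCategory.snd A X).left
      (SemiCartesianMonoidalCategory.snd A Y).left f.left := by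
  have h₁ : IsPullback (SemiCartesianMonoidalCategory.fst A Y).left
      (SemiCartesianMonoidalCategory.snd A Y).left A.hom Y.hom := IsPullback.of_hasPullback _ _
  have h₂ : IsPullback (SemiCartesianMonoidalCategory.fst A X).left
      (SemiCartesianMonoidalCategory.snd A X).left A.hom X.hom := IsPullback.of_hasPullback _ _
  refine IsPullback.of_right (h₁₂ := (SemiCartesianMonoidalCategory.fst A Y).left)
    (h₂₂ := Y.hom) (v₁₃ := A.hom) ?_ ?_ h₁
  · rw [← Over.comp_left, CartesianMonoidalCategory.whiskerLeft_fst, Over.w]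
    exact h₂
  · rw [← Over.comp_left, ← Over.comp_left, CartesianMonoidalCategory.whiskerLeft_snd]

/-- The morphism is the base change of `f` along the flat projection to `Y`, and density of
quasi-compact morphisms survives flat base change. Over a field the flatness of `A` is automatic. -/
instance isSchemeTheoreticallyDominant_whiskerLeft (A : Over S) [Flat A.hom] {X Y : Over S}
    (f : X ⟶ Y) [IsSchemeTheoreticallyDominant f.left] [QuasiCompact f.left] :
    IsSchemeTheoreticallyDominant (A ◁ f).left := by
  have : Flat (SemiCartesianMonoidalCategory.snd A Y).left :=
    inferInstanceAs (Flat (pullback.snd A.hom Y.hom))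
  exact .of_isPullback (isPullback_whiskerLeft_left A f).flip

end Dominant

/-- The closed subscheme `j` of the image cut out by the kernel of `f.toImage` has, as a subscheme
of `Y`, the kernel of `f` as its ideal. The image has the same ideal, so `j` is an isomorphism and
the kernel of `f.toImage` is zero. -/
lemma isSchemeTheoreticallyDominant_toImage {X Y : Scheme.{u}} (f : X ⟶ Y) :
    IsSchemeTheoreticallyDominant f.toImage := by
  let j := f.toImage.ker.subschemeι
  have hker : (j ≫ f.imageι).ker = f.imageι.ker := by
    have h₁ : (j ≫ f.imageι).ker = f.toImage.ker.map f.imageι := rfl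
    rw [h₁, ← Scheme.Hom.ker_comp, f.toImage_imageι]
    exact f.ker.ker_subschemeι.symm
  have : IsIso j := IsClosedImmersion.isIso_of_ker_eq (j ≫ f.imageι) f.imageι j rfl hker
  rw [isSchemeTheoreticallyDominant_iff, ← f.toImage.ker.ker_subschemeι]
  exact j.ker_eq_bot_of_isIso

/-! ### Torus orbits and their closures -/

section Orbit

variable {N : Type u} [AddCommGroup N] (k : Type u) [Field k] (Δ : Fan N)
  (σ : {σ // σ ∈ Δ.cones})

instance isOpenImmersion_chart : IsOpenImmersion (chart k Δ σ).left :=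
  (chartCover k Δ).map_prop σ

instance isClosedImmersion_orbitClosureIncl : IsClosedImmersion (orbitClosureIncl k Δ σ).left :=
  inferInstanceAs (IsClosedImmersion (orbit k Δ σ).left.imageι)

instance : Mono (orbitClosureIncl k Δ σ) :=
  Over.mono_of_mono_left _

instance : Mono (chart k Δ σ) :=
  Over.mono_of_mono_left _

lemma orbitToClosure_orbitClosureIncl :
    orbitToClosure k Δ σ ≫ orbitClosureIncl k Δ σ = orbit k Δ σ :=
  Over.OverMorphism.ext (Scheme.Hom.toImage_imageι _)

/-- The orbit is closed in the chart of its cone, and the chart is open. -/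
instance isImmersion_orbit : IsImmersion (orbit k Δ σ).left := by
  have := isClosedImmersion_affineMap k _ (orbitHom_surjective k (Δ.rational _ σ.2))
  exact inferInstanceAs
    (IsImmersion ((affineMap k (orbitHom k σ.1)).left ≫ (chart k Δ σ).left))

/-- On the dense orbit only the image of `a` in the quotient torus matters. Every density argument
on the closure starts from this formula. -/
lemma whiskerLeft_orbitToClosure_torusAction {A : Over (Spec (CommRingCat.of k))}
    (a : A ⟶ torus N k) :
    (A ◁ orbitToClosure k Δ σ) ≫ (a ▷ orbitClosure k Δ σ) ≫
        (torus N k ◁ orbitClosureIncl k Δ σ) ≫ torusAction k Δ =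
      ((a ≫ torusMap k (latticeOf σ.1).mkQ) ▷ torus (N ⧸ latticeOf σ.1) k) ≫ MonObj.mul ≫
        orbit k Δ σ := by
  rw [MonoidalCategory.whisker_exchange_assoc, ← MonoidalCategory.whiskerLeft_comp_assoc,
    orbitToClosure_orbitClosureIncl, orbit_torusAction, MonoidalCategory.comp_whiskerRight_assoc]

variable [Module.Finite ℤ N]

instance : IsNoetherianRing (AddMonoidAlgebra k (Module.Dual ℤ N)) := by
  have : Module.Finite ℤ (Module.Dual ℤ N) := inferInstance
  have : AddMonoid.FG (Module.Dual ℤ N) :=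
    AddGroup.fg_iff_addMonoid_fg.1 (Module.Finite.iff_addGroup_fg.1 this)
  have : Algebra.FiniteType k (AddMonoidAlgebra k (Module.Dual ℤ N)) := inferInstance
  exact Algebra.FiniteType.isNoetherianRing k _

/-- The source is noetherian. Quasi-compactness is needed for the flat base change of density. -/
instance quasiCompact_orbit : QuasiCompact (orbit k Δ σ).left := by
  have : IsNoetherian (torus (N ⧸ latticeOf σ.1) k).left :=
    inferInstanceAs (IsNoetherian (Spec (CommRingCat.of
      (AddMonoidAlgebra k (Module.Dual ℤ (N ⧸ latticeOf σ.1))))))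
  infer_instance

instance isOpenImmersion_orbitToClosure : IsOpenImmersion (orbitToClosure k Δ σ).left :=
  inferInstanceAs (IsOpenImmersion (orbit k Δ σ).left.toImage)

instance quasiCompact_orbitToClosure : QuasiCompact (orbitToClosure k Δ σ).left :=
  inferInstanceAs (QuasiCompact (orbit k Δ σ).left.toImage)

instance isDominant_orbitToClosure : IsDominant (orbitToClosure k Δ σ).left :=
  inferInstanceAs (IsDominant (orbit k Δ σ).left.toImage)

instance isSchemeTheoreticallyDominant_orbitToClosure :
    IsSchemeTheoreticallyDominant (orbitToClosure k Δ σ).left :=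
  isSchemeTheoreticallyDominant_toImage (orbit k Δ σ).left

/-- The action of the torus on an orbit closure only depends on the image in the quotient torus. -/
lemma whiskerRight_orbitClosureIncl_torusAction_congr {A : Over (Spec (CommRingCat.of k))}
    {a b : A ⟶ torus N k}
    (h : a ≫ torusMap k (latticeOf σ.1).mkQ = b ≫ torusMap k (latticeOf σ.1).mkQ) :
    (a ▷ orbitClosure k Δ σ) ≫ (torus N k ◁ orbitClosureIncl k Δ σ) ≫ torusAction k Δ =
      (b ▷ orbitClosure k Δ σ) ≫ (torus N k ◁ orbitClosureIncl k Δ σ) ≫ torusAction k Δ := by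
  -- Density determines morphisms only into a separated target, here an affine one. The closure is
  -- therefore covered by its intersections with the charts.
  let 𝒰 : (orbitClosure k Δ σ).left.OpenCover :=
    Precoverage.ZeroHypercover.pullback₁ (orbitClosureIncl k Δ σ).left (chartCover k Δ)
  refine whiskerLeft_cover_hom_ext 𝒰 fun γ => ?_
  let V := coverObj (orbitClosure k Δ σ) 𝒰 γ
  let c : V ⟶ orbitClosure k Δ σ := coverIncl (orbitClosure k Δ σ) 𝒰 γ
  obtain ⟨δ, m, hm⟩ : ∃ (δ : {σ // σ ∈ Δ.cones}) (m : V ⟶ affineToric k δ.1),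
      c ≫ orbitClosureIncl k Δ σ = m ≫ chart k Δ δ := by
    have e : c.left ≫ (orbitClosureIncl k Δ σ).left =
        pullback.snd (orbitClosureIncl k Δ σ).left ((chartCover k Δ).f γ) ≫ (chart k Δ γ).left :=
      pullback.condition
    refine ⟨γ, Over.homMk (pullback.snd (orbitClosureIncl k Δ σ).left ((chartCover k Δ).f γ)) ?_,
      Over.OverMorphism.ext e⟩
    rw [← Over.w (chart k Δ γ), ← Over.w c, ← Over.w (orbitClosureIncl k Δ σ)]
    exact ((Category.assoc _ _ _).symm.trans (congrArg (· ≫ (toricVariety k Δ).hom) e.symm)).trans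
      (Category.assoc _ _ _)
  -- `W` is the part of the dense orbit in the chart
  have : IsOpenImmersion c.left := 𝒰.map_prop γ
  let W : Over (Spec (CommRingCat.of k)) :=
    Over.mk (pullback.snd (orbitToClosure k Δ σ).left c.left ≫ V.hom)
  let n : W ⟶ V := Over.homMk (pullback.snd (orbitToClosure k Δ σ).left c.left) rfl
  have hn : ∃ n' : W ⟶ torus (N ⧸ latticeOf σ.1) k, n ≫ c = n' ≫ orbitToClosure k Δ σ := by
    have e := pullback.condition (f := (orbitToClosure k Δ σ).left) (g := c.left)
    refine ⟨Over.homMk (pullback.fst (orbitToClosure k Δ σ).left c.left) ?_,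
      Over.OverMorphism.ext e.symm⟩
    rw [← Over.w (orbitToClosure k Δ σ)]
    refine (Category.assoc _ _ _).symm.trans ((congrArg (· ≫ (orbitClosure k Δ σ).hom) e).trans ?_)
    exact (Category.assoc _ _ _).trans (congrArg (n.left ≫ ·) (Over.w c))
  obtain ⟨n', hn'⟩ := hn
  -- The torus preserves the chart, so on `V` the action takes values in the affine scheme `U_δ`.
  have hlocal : ∀ a : A ⟶ torus N k, (A ◁ c) ≫ (a ▷ orbitClosure k Δ σ) ≫
      (torus N k ◁ orbitClosureIncl k Δ σ) ≫ torusAction k Δ =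
        ((a ▷ V) ≫ (torus N k ◁ m) ≫ affineAction k δ.1) ≫ chart k Δ δ := by
    intro a
    rw [MonoidalCategory.whisker_exchange_assoc, ← MonoidalCategory.whiskerLeft_comp_assoc, hm,
      MonoidalCategory.whiskerLeft_comp_assoc, chart_torusAction, Category.assoc, Category.assoc]
  have key : (a ▷ V) ≫ (torus N k ◁ m) ≫ affineAction k δ.1 =
      (b ▷ V) ≫ (torus N k ◁ m) ≫ affineAction k δ.1 := by
    have : IsSchemeTheoreticallyDominant n.left :=
      inferInstanceAs (IsSchemeTheoreticallyDominant
        (pullback.snd (orbitToClosure k Δ σ).left c.left))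
    have : QuasiCompact n.left :=
      inferInstanceAs (QuasiCompact (pullback.snd (orbitToClosure k Δ σ).left c.left))
    have : IsAffine (affineToric k δ.1).left :=
      inferInstanceAs (IsAffine (Spec (CommRingCat.of (coordRing k δ.1))))
    -- On `W` both sides are multiplication in the orbit by the same point of the quotient torus.
    -- The chart is a monomorphism, so the equality may be tested in the toric variety.
    have e : (A ◁ n) ≫ (a ▷ V) ≫ (torus N k ◁ m) ≫ affineAction k δ.1 =
        (A ◁ n) ≫ (b ▷ V) ≫ (torus N k ◁ m) ≫ affineAction k δ.1 := by
      rw [← cancel_mono (chart k Δ δ), Category.assoc (A ◁ n), Category.assoc (A ◁ n),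
        ← hlocal, ← hlocal,
        ← MonoidalCategory.whiskerLeft_comp_assoc, ← MonoidalCategory.whiskerLeft_comp_assoc, hn',
        MonoidalCategory.whiskerLeft_comp_assoc, MonoidalCategory.whiskerLeft_comp_assoc,
        whiskerLeft_orbitToClosure_torusAction, whiskerLeft_orbitToClosure_torusAction, h]
    exact Over.OverMorphism.ext (hom_ext_of_isSchemeTheoreticallyDominant (A ◁ n).left
      (congrArg (fun a : A ⊗ W ⟶ affineToric k δ.1 => Over.Hom.left a) e))
  exact (hlocal a).trans ((congrArg (· ≫ chart k Δ δ) key).trans (hlocal b).symm)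

end Orbit

/-! ### The action of the quotient torus on an orbit closure -/

section ClosureAction

variable {N : Type u} [AddCommGroup N] [Module.Finite ℤ N] (k : Type u) [Field k] (Δ : Fan N)
  (σ : {σ // σ ∈ Δ.cones})

/-- A subtorus acts on the closure of an orbit. -/
lemma exists_orbitClosure_lift {A : Over (Spec (CommRingCat.of k))} (a : A ⟶ torus N k) :
    ∃ f : A ⊗ orbitClosure k Δ σ ⟶ orbitClosure k Δ σ,
      f ≫ orbitClosureIncl k Δ σ = (a ▷ orbitClosure k Δ σ) ≫
        (torus N k ◁ orbitClosureIncl k Δ σ) ≫ torusAction k Δ := by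
  -- On the dense part `A ⊗ T_v` the action is multiplication in the orbit, which stays in the
  -- closure. Since the closure is closed, the factorization extends to all of the product.
  have e : (A ◁ orbitToClosure k Δ σ) ≫ (a ▷ orbitClosure k Δ σ) ≫
      (torus N k ◁ orbitClosureIncl k Δ σ) ≫ torusAction k Δ =
        (((a ≫ torusMap k (latticeOf σ.1).mkQ) ▷ torus (N ⧸ latticeOf σ.1) k) ≫ MonObj.mul ≫
          orbitToClosure k Δ σ) ≫ orbitClosureIncl k Δ σ := by
    rw [whiskerLeft_orbitToClosure_torusAction, Category.assoc, Category.assoc,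
      orbitToClosure_orbitClosureIncl]
  obtain ⟨g, hg⟩ := exists_lift_of_isSchemeTheoreticallyDominant (A ◁ orbitToClosure k Δ σ).left
    (orbitClosureIncl k Δ σ).left _ _ (congrArg (fun a => Over.Hom.left a) e)
  refine ⟨Over.homMk g ?_, Over.OverMorphism.ext hg⟩
  rw [← Over.w (orbitClosureIncl k Δ σ), reassoc_of% hg]
  exact Over.w _

/-- The torus of an orbit acts on the closure of the orbit, and the torus of the toric variety
acts on it through its quotient. -/
theorem exists_modObj_orbitClosure :
    ∃ A : ModObj (torus (N ⧸ latticeOf σ.1) k) (orbitClosure k Δ σ),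
      (torus (N ⧸ latticeOf σ.1) k ◁ orbitToClosure k Δ σ) ≫ actionHom A =
        MonObj.mul ≫ orbitToClosure k Δ σ ∧
      (torus N k ◁ orbitClosureIncl k Δ σ) ≫ torusAction k Δ =
        (torusMap k (latticeOf σ.1).mkQ ▷ orbitClosure k Δ σ) ≫ actionHom A ≫
          orbitClosureIncl k Δ σ := by
  obtain ⟨s, hs⟩ := exists_section_mkQ σ.1
  have hs' : torusMap k s ≫ torusMap k (latticeOf σ.1).mkQ = 𝟙 _ := by
    rw [torusMap_comp, hs, torusMap_id]
  -- The quotient torus acts through the homomorphic section `s`. The axioms can be checked after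
  -- the monomorphism into the toric variety, where they are those of the big torus.
  obtain ⟨f, hf⟩ := exists_orbitClosure_lift k Δ σ (torusMap k s)
  refine ⟨{ smul := f, one_smul := ?_, mul_smul := ?_ }, ?_, ?_⟩
  · change (MonObj.one ▷ orbitClosure k Δ σ) ≫ f = (λ_ (orbitClosure k Δ σ)).hom
    rw [← cancel_mono (orbitClosureIncl k Δ σ), Category.assoc, hf,
      ← MonoidalCategory.comp_whiskerRight_assoc, IsMonHom.one_hom,
      ← MonoidalCategory.whisker_exchange_assoc, one_torusAction,
      MonoidalCategory.leftUnitor_naturality]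
  · change (MonObj.mul ▷ orbitClosure k Δ σ) ≫ f = (α_ _ _ (orbitClosure k Δ σ)).hom ≫
      (torus (N ⧸ latticeOf σ.1) k ◁ f) ≫ f
    rw [← cancel_mono (orbitClosureIncl k Δ σ)]
    simp only [Category.assoc, hf]
    rw [← MonoidalCategory.comp_whiskerRight_assoc, IsMonHom.mul_hom,
      MonoidalCategory.comp_whiskerRight_assoc, ← MonoidalCategory.whisker_exchange_assoc,
      mul_torusAction, MonoidalCategory.whisker_exchange_assoc,
      ← MonoidalCategory.whiskerLeft_comp_assoc, hf, MonoidalCategory.tensorHom_def]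
    simp only [MonoidalCategory.comp_whiskerRight, MonoidalCategory.whiskerLeft_comp,
      Category.assoc, MonoidalCategory.associator_naturality_left_assoc,
      MonoidalCategory.associator_naturality_middle_assoc,
      MonoidalCategory.associator_naturality_right_assoc]
  · change (torus (N ⧸ latticeOf σ.1) k ◁ orbitToClosure k Δ σ) ≫ f = _
    rw [← cancel_mono (orbitClosureIncl k Δ σ), Category.assoc, hf,
      whiskerLeft_orbitToClosure_torusAction, hs', MonoidalCategory.id_whiskerRight,
      Category.id_comp, Category.assoc, orbitToClosure_orbitClosureIncl]
  · change _ = (torusMap k (latticeOf σ.1).mkQ ▷ orbitClosure k Δ σ) ≫ f ≫ orbitClosureIncl k Δ σ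
    rw [hf, ← MonoidalCategory.comp_whiskerRight_assoc]
    -- The identity of the big torus and its projection to the copy of the quotient given by `s`
    -- have the same image in the quotient, hence act equally on the closure.
    have h := whiskerRight_orbitClosureIncl_torusAction_congr k Δ σ (a := 𝟙 (torus N k))
      (b := torusMap k (latticeOf σ.1).mkQ ≫ torusMap k s) (by
        rw [Category.assoc, hs', Category.comp_id, Category.id_comp])
    rwa [MonoidalCategory.id_whiskerRight, Category.id_comp] at h

end ClosureAction

/-! ### Closed orbits and distinguished points in coordinates -/

section Fibre

variable {N N' : Type u} [AddCommGroup N] [AddCommGroup N'] (k : Type u) [Field k]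

lemma pullbackHom_single (f : N →ₗ[ℤ] N') {σ : RealCone N} {σ' : RealCone N'}
    (h : σ.map (realMap f) ≤ σ') (m : dualMonoid σ') (m' : dualMonoid σ)
    (hm : m'.1 = m.1 ∘ₗ f) :
    pullbackHom k f h (AddMonoidAlgebra.single m 1) = AddMonoidAlgebra.single m' 1 := by
  rw [pullbackHom, AddMonoidAlgebra.mapDomainAlgHom_apply, AddMonoidAlgebra.mapDomain_single]
  congr 1
  exact Subtype.ext hm.symm

lemma chart_toricMap (f : N →ₗ[ℤ] N') (Δ : Fan N) (σ' : RealCone N')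
    (h : ∀ σ ∈ Δ.cones, σ.map (realMap f) ≤ σ') (σ : {σ // σ ∈ Δ.cones}) :
    chart k Δ σ ≫ toricMap k f Δ σ' h = affineMap k (pullbackHom k f (h σ.1 σ.2)) :=
  Over.OverMorphism.ext (by exact colimit.ι_desc _ _)

/-- A homomorphism of `k`-algebras to `k` is surjective. Consequently the central fibre is closed in
`X_Υ`. -/
lemma isClosedImmersion_distinguishedPoint (σ : RealCone N) :
    IsClosedImmersion (distinguishedPoint k σ).left := by
  refine isClosedImmersion_affineMap k _ fun a => ⟨algebraMap k _ a, ?_⟩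
  rw [AlgHom.commutes]
  rfl

/-- A functional that vanishes on a full-dimensional cone is zero. -/
lemma eq_zero_of_pairing_eq_zero {σ : RealCone N} (hσ : IsFullDimensional σ)
    {m : Module.Dual ℤ N} (hm : ∀ x ∈ σ, pairing m x = 0) : m = 0 := by
  refine LinearMap.ext fun n => ?_
  refine latticeOf_le_ker hm ?_
  change latticeIncl N n ∈ Submodule.span ℝ (σ : Set (RealSpace N))
  rw [hσ]
  trivial

/-- A prime ideal of the coordinate ring of `U_σ` comes from the closed orbit if it contains the
characters that do not vanish on `σ`. -/
lemma mem_range_orbitHom {σ : RealCone N} (hσ : IsRationalPolyhedral σ)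
    (p : PrimeSpectrum (coordRing k σ))
    (hp : ∀ m : dualMonoid σ, (¬ ∀ x ∈ σ, pairing m.1 x = 0) →
      AddMonoidAlgebra.single m 1 ∈ p.asIdeal) :
    p ∈ Set.range (affineMap k (orbitHom k σ)).left := by
  -- Modulo `p` a function equals its part supported on characters vanishing on `σ`, since the
  -- remaining characters lie in `p`. It follows that `p` contains the kernel of `orbitHom`.
  have hsec : ∀ f : coordRing k σ, f - orbitSection k hσ (orbitHom k σ f) ∈ p.asIdeal := by
    intro f
    induction f using AddMonoidAlgebra.induction_linear with
    | zero => simp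
    | add f g hf hg =>
      rw [map_add, map_add, add_sub_add_comm]
      exact add_mem hf hg
    | single m a =>
      have e : (AddMonoidAlgebra.single m a : coordRing k σ) = a • AddMonoidAlgebra.single m 1 := by
        rw [AddMonoidAlgebra.smul_single, smul_eq_mul, mul_one]
      rw [e, map_smul, map_smul, ← smul_sub, Algebra.smul_def]
      refine Ideal.mul_mem_left _ _ ?_
      by_cases h : ∀ x ∈ σ, pairing m.1 x = 0
      · rw [orbitSection_orbitHom_single k hσ m h, sub_self]
        exact zero_mem _
      · rw [orbitHom_single_of_not_vanishing k σ m h, map_zero, sub_zero]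
        exact hp m h
  have hker : RingHom.ker (orbitHom k σ).toRingHom ≤ p.asIdeal := by
    intro f hf
    have h := hsec f
    rwa [show orbitHom k σ f = 0 from hf, map_zero, sub_zero] at h
  have hrange := range_comap_of_surjective _ (orbitHom k σ).toRingHom (orbitHom_surjective k hσ)
  have : p ∈ PrimeSpectrum.zeroLocus (RingHom.ker (orbitHom k σ).toRingHom : Set (coordRing k σ)) :=
    hker
  rw [← hrange] at this
  exact this

end Fibre

/-! ### The stratum `Y_v` as a component of the central fibre -/

namespace TropicalExpansion.Vertex

variable {N L : Type u} [AddCommGroup N] [AddCommGroup L] {Sig : Fan N} {τ : BaseCone L}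
  {Υ : TropicalExpansion Sig τ} (v : Υ.Vertex) (k : Type u) [Field k]

lemma snd_vanishing_iff (m : Module.Dual ℤ L) :
    (∀ x ∈ v.cone, pairing (m ∘ₗ LinearMap.snd ℤ N L) x = 0) ↔ ∀ y ∈ τ.cone, pairing m y = 0 := by
  rw [← v.map_cone]
  constructor
  · rintro h _ ⟨x, hx, rfl⟩
    exact (pairing_realMap (LinearMap.snd ℤ N L) m x).trans (h x hx)
  · intro h x hx
    exact (pairing_realMap (LinearMap.snd ℤ N L) m x).symm.trans (h _ ⟨x, hx, rfl⟩)

lemma chart_toBase : chart k Υ.fan ⟨v.cone, v.mem⟩ ≫ Υ.toBase k =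
    affineMap k (pullbackHom k (LinearMap.snd ℤ N L) v.map_cone.le) :=
  chart_toricMap k _ _ _ _ _

lemma torusIncl_comp_of_comp_eq {F : Scheme.{u}} {c : F ⟶ (Υ.total k).left}
    {i : (v.component k).left ⟶ F} (hi : i ≫ c = (v.componentIncl k).left) :
    (v.torusIncl k).left ≫ i ≫ c =
      (affineMap k (orbitHom k v.cone)).left ≫ (chart k Υ.fan ⟨v.cone, v.mem⟩).left := by
  rw [hi]
  exact congrArg (fun a => Over.Hom.left a)
    (orbitToClosure_orbitClosureIncl k Υ.fan ⟨v.cone, v.mem⟩)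

/-- The orbit lies over `0`. A functional that vanishes on the full-dimensional `τ` is zero and
gives the constant `1`; any other pulls back to one not vanishing on `ω_v`, because `ω_v` maps onto
`τ`, and so restricts to zero. -/
lemma orbitHom_comp_pullbackHom (h : v.cone.map (projBase N L) ≤ τ.cone) :
    (orbitHom k v.cone).comp (pullbackHom k (LinearMap.snd ℤ N L) h) =
      (Algebra.ofId k _).comp ((Bialgebra.counitAlgHom k _).comp (orbitHom k τ.cone)) := by
  refine AddMonoidAlgebra.algHom_ext (fun m => ?_) (by ext)
  have hm : m.1 ∘ₗ LinearMap.snd ℤ N L ∈ dualMonoid v.cone := fun x hx =>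
    (m.2 _ (h ⟨x, hx, rfl⟩)).trans (pairing_realMap (LinearMap.snd ℤ N L) m.1 x).le
  rw [AlgHom.comp_apply, AlgHom.comp_apply, AlgHom.comp_apply,
    pullbackHom_single k _ h m ⟨_, hm⟩ rfl]
  by_cases h0 : ∀ y ∈ τ.cone, pairing m.1 y = 0
  · rw [orbitHom_single_of_vanishing k _ m h0,
      orbitHom_single_of_vanishing k _ ⟨_, hm⟩ ((v.snd_vanishing_iff m.1).2 h0)]
    have hm0 : m.1 = 0 := eq_zero_of_pairing_eq_zero τ.fullDimensional h0
    have e : (latticeOf v.cone).liftQ (m.1 ∘ₗ LinearMap.snd ℤ N L)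
        (latticeOf_le_ker ((v.snd_vanishing_iff m.1).2 h0)) = 0 := by
      refine Submodule.linearMap_qext _ ?_
      rw [Submodule.liftQ_mkQ, hm0]
      rfl
    rw [e]
    simp
  · rw [orbitHom_single_of_not_vanishing k _ m h0, orbitHom_single_of_not_vanishing k _ ⟨_, hm⟩
      (fun h' => h0 ((v.snd_vanishing_iff m.1).1 h')), map_zero, map_zero]

lemma orbit_toBase : orbit k Υ.fan ⟨v.cone, v.mem⟩ ≫ Υ.toBase k =
    affineMap k (Algebra.ofId k _) ≫ distinguishedPoint k τ.cone := by
  rw [orbit, Category.assoc, v.chart_toBase, affineMap_comp, v.orbitHom_comp_pullbackHom,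
    ← affineMap_comp, distinguishedPoint]

/-- Both sides map to the affine scheme `U_τ` and agree on the dense torus `T_v`. This is what makes
`Y_v` a subscheme of the fibre and not merely a subset. -/
lemma componentIncl_toBase : (v.componentIncl k).left ≫ (Υ.toBase k).left =
    (v.component k).hom ≫ (distinguishedPoint k τ.cone).left := by
  have : IsAffine (affineToric k τ.cone).left :=
    inferInstanceAs (IsAffine (Spec (CommRingCat.of (coordRing k τ.cone))))
  refine hom_ext_of_isSchemeTheoreticallyDominant (v.torusIncl k).left ?_
  have h₁ : (orbit k Υ.fan ⟨v.cone, v.mem⟩).left ≫ (Υ.toBase k).left =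
      (v.denseTorus k).hom ≫ (distinguishedPoint k τ.cone).left :=
    congrArg (fun a => Over.Hom.left a) (v.orbit_toBase k)
  have h₂ : (v.torusIncl k).left ≫ (v.componentIncl k).left =
      (orbit k Υ.fan ⟨v.cone, v.mem⟩).left :=
    congrArg (fun a => Over.Hom.left a) (orbitToClosure_orbitClosureIncl k Υ.fan ⟨v.cone, v.mem⟩)
  rw [← Category.assoc, h₂, h₁, ← Over.w (v.torusIncl k)]
  exact Category.assoc _ _ _

variable [Module.Free ℤ N] [Module.Free ℤ L]

/-- A character of the chart of a vertex is the product of a character of the base and one that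
is invertible on the chart. -/
lemma exists_eq_snd_add (m : dualMonoid v.cone) :
    ∃ m' : dualMonoid τ.cone, ∃ a b : dualMonoid v.cone, m = a + b ∧
      a.1 = m'.1 ∘ₗ LinearMap.snd ℤ N L ∧ ∀ x ∈ v.cone, pairing b.1 x = 0 := by
  let e := LinearEquiv.ofBijective _ v.bijective_projBase
  -- The functional `m` restricted to `N_{ω_v}`, transported to `N_τ` by the isomorphism induced by
  -- `p`. Hence `m - m' ∘ p` vanishes on `N_{ω_v}`.
  let m' : Module.Dual ℤ L := m.1 ∘ₗ (latticeOf v.cone).subtype ∘ₗ e.symm.toLinearMap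
  have hb : ∀ x ∈ v.cone, pairing (m.1 - m' ∘ₗ LinearMap.snd ℤ N L) x = 0 := by
    refine pairing_eq_zero_of_latticeOf_le_ker (Υ.fan.rational _ v.mem) fun n hn => ?_
    have h : e.symm n.2 = ⟨n, hn⟩ := e.symm_apply_apply ⟨n, hn⟩
    rw [LinearMap.mem_ker]
    change m.1 n - m.1 (e.symm n.2).1 = 0
    rw [h, sub_self]
  have hpair : ∀ x ∈ v.cone, pairing (m' ∘ₗ LinearMap.snd ℤ N L) x = pairing m.1 x := by
    intro x hx
    have := pairing_add (m.1 - m' ∘ₗ LinearMap.snd ℤ N L) (m' ∘ₗ LinearMap.snd ℤ N L) x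
    rw [sub_add_cancel, hb x hx, zero_add] at this
    exact this.symm
  have hm' : m' ∈ dualMonoid τ.cone := by
    rw [← v.map_cone]
    rintro _ ⟨x, hx, rfl⟩
    have h₁ : pairing m' (projBase N L x) = pairing m.1 x :=
      (pairing_realMap (LinearMap.snd ℤ N L) m' x).trans (hpair x hx)
    exact (m.2 x hx).trans h₁.ge
  refine ⟨⟨m', hm'⟩, ⟨m' ∘ₗ LinearMap.snd ℤ N L, fun x hx => ?_⟩,
    ⟨m.1 - m' ∘ₗ LinearMap.snd ℤ N L, fun x hx => (hb x hx).ge⟩, ?_, rfl, hb⟩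
  · rw [hpair x hx]
    exact m.2 x hx
  · exact Subtype.ext (add_sub_cancel _ _).symm

/-- In the chart of a vertex, the fibre over the fixed point is the closed orbit. -/
lemma mem_range_orbitHom_of_fibre (p : PrimeSpectrum (coordRing k v.cone)) (y : PrimeSpectrum k)
    (hp : (affineMap k (pullbackHom k (LinearMap.snd ℤ N L) v.map_cone.le)).left p =
      (distinguishedPoint k τ.cone).left y) :
    p ∈ Set.range (affineMap k (orbitHom k v.cone)).left := by
  refine mem_range_orbitHom k (Υ.fan.rational _ v.mem) p fun m hm => ?_
  obtain ⟨m', a, b, rfl, ha, hb⟩ := v.exists_eq_snd_add m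
  -- Otherwise both summands `a` and `b` would vanish on `ω_v`. Consequently `χ^{m'}` is zero at
  -- `0`, which puts its pullback `χ^a`, and with it `χ^{a+b}`, in `p`.
  have hm' : ¬ ∀ y ∈ τ.cone, pairing m'.1 y = 0 := by
    rw [← v.snd_vanishing_iff, ← ha]
    intro h
    refine hm fun x hx => ?_
    have := pairing_add a.1 b.1 x
    rw [h x hx, hb x hx, add_zero] at this
    exact this
  have h₁ : AddMonoidAlgebra.single m' (1 : k) ∈
      ((distinguishedPoint k τ.cone).left y : PrimeSpectrum (coordRing k τ.cone)).asIdeal := by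
    change (Bialgebra.counitAlgHom k _) (orbitHom k τ.cone (AddMonoidAlgebra.single m' 1)) ∈
      y.asIdeal
    rw [orbitHom_single_of_not_vanishing k _ m' hm', map_zero]
    exact zero_mem _
  rw [← hp] at h₁
  have h₂ : pullbackHom k (LinearMap.snd ℤ N L) v.map_cone.le (AddMonoidAlgebra.single m' 1) ∈
      p.asIdeal := h₁
  rw [pullbackHom_single k _ _ m' a ha] at h₂
  have h₃ : (AddMonoidAlgebra.single (a + b) 1 : coordRing k v.cone) =
      AddMonoidAlgebra.single b 1 * AddMonoidAlgebra.single a 1 := by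
    rw [AddMonoidAlgebra.single_mul_single, mul_one, add_comm]
  rw [h₃]
  exact Ideal.mul_mem_left _ _ h₂

/-- In the chart of a vertex, the central fibre is the component of the vertex. -/
lemma mem_range_of_mem_chart (i : (v.component k).left ⟶ Υ.centralFibre k)
    (hi : i ≫ Υ.centralFibreIncl k = (v.componentIncl k).left) (x : Υ.centralFibre k)
    (hx : Υ.centralFibreIncl k x ∈ Set.range (chart k Υ.fan ⟨v.cone, v.mem⟩).left) :
    x ∈ Set.range i := by
  have hd := isClosedImmersion_distinguishedPoint k τ.cone
  have hc : IsClosedImmersion (Υ.centralFibreIncl k) :=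
    inferInstanceAs (IsClosedImmersion (pullback.fst _ _))
  obtain ⟨p, hp⟩ := hx
  have h₁ : (chart k Υ.fan ⟨v.cone, v.mem⟩).left ≫ (Υ.toBase k).left =
      (affineMap k (pullbackHom k (LinearMap.snd ℤ N L) v.map_cone.le)).left :=
    congrArg (fun a => Over.Hom.left a) (v.chart_toBase k)
  have h₂ : Υ.centralFibreIncl k ≫ (Υ.toBase k).left =
      pullback.snd (Υ.toBase k).left (distinguishedPoint k τ.cone).left ≫
        (distinguishedPoint k τ.cone).left := pullback.condition
  obtain ⟨t, rfl⟩ := v.mem_range_orbitHom_of_fibre k p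
    (pullback.snd (Υ.toBase k).left (distinguishedPoint k τ.cone).left x) (by
      rw [← h₁]
      refine Eq.trans ?_ congr($h₂ x)
      exact congrArg (Υ.toBase k).left hp)
  refine ⟨(v.torusIncl k).left t, (Υ.centralFibreIncl k).isClosedEmbedding.injective ?_⟩
  rw [← hp]
  exact congr($(v.torusIncl_comp_of_comp_eq k hi) t)

variable [Module.Finite ℤ N] [Module.Finite ℤ L]

/-- A free abelian group of finite rank inherits the property from its coordinates in a basis. It
excludes zero divisors in the group algebra, so `T_v` is integral and `Y_v` irreducible. -/
instance : TwoUniqueSums (Module.Dual ℤ v.lattice) :=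
  TwoUniqueSums.of_injective_addHom (Module.Free.chooseBasis ℤ _).repr.toAddEquiv.toAddHom
    (Module.Free.chooseBasis ℤ _).repr.injective inferInstance

instance irreducibleSpace_component : IrreducibleSpace (v.component k).left := by
  have : IsDomain (AddMonoidAlgebra k (Module.Dual ℤ v.lattice)) := NoZeroDivisors.to_isDomain _
  have : IrreducibleSpace (v.denseTorus k).left :=
    inferInstanceAs (IrreducibleSpace (PrimeSpectrum
      (AddMonoidAlgebra k (Module.Dual ℤ v.lattice))))
  have hrange : IsIrreducible (Set.range (v.torusIncl k).left) := by
    rw [← Set.image_univ]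
    exact (IrreducibleSpace.isIrreducible_univ _).image _
      (v.torusIncl k).left.continuous.continuousOn
  rw [irreducibleSpace_def, Set.top_eq_univ, ← (v.torusIncl k).left.denseRange.closure_eq]
  exact hrange.closure

theorem exists_closedImmersion_centralFibre :
    ∃ i : (v.component k).left ⟶ Υ.centralFibre k, IsClosedImmersion i ∧
      i ≫ Υ.centralFibreIncl k = (v.componentIncl k).left ∧
      Set.range i ∈ irreducibleComponents (Υ.centralFibre k) := by
  have hd := isClosedImmersion_distinguishedPoint k τ.cone
  have hc : IsClosedImmersion (Υ.centralFibreIncl k) :=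
    inferInstanceAs (IsClosedImmersion (pullback.fst _ _))
  let i : (v.component k).left ⟶ Υ.centralFibre k :=
    pullback.lift (v.componentIncl k).left (v.component k).hom (v.componentIncl_toBase k)
  have hi : i ≫ Υ.centralFibreIncl k = (v.componentIncl k).left := pullback.lift_fst _ _ _
  have hci : IsClosedImmersion i := by
    have : IsClosedImmersion (i ≫ Υ.centralFibreIncl k) := hi ▸ inferInstance
    exact IsClosedImmersion.of_comp_isClosedImmersion i (Υ.centralFibreIncl k)
  refine ⟨i, hci, hi, ?_, fun Z hZ hle => ?_⟩
  · rw [← Set.image_univ]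
    exact (IrreducibleSpace.isIrreducible_univ _).image _ i.continuous.continuousOn
  -- Maximality: an irreducible closed or non-closed `Z` containing `Y_v` meets the open trace `W`
  -- of the chart of `ω_v`, so `Z` lies in the closure of `Z ∩ W`. The fibre inside the chart is
  -- contained in `Y_v`, which is closed.
  let W : Set (Υ.centralFibre k) :=
    Υ.centralFibreIncl k ⁻¹' Set.range (chart k Υ.fan ⟨v.cone, v.mem⟩).left
  have hW : IsOpen W :=
    (chart k Υ.fan ⟨v.cone, v.mem⟩).left.isOpenEmbedding.isOpen_range.preimage
      (Υ.centralFibreIncl k).continuous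
  have hne : (Z ∩ W).Nonempty := by
    obtain ⟨t⟩ : Nonempty (v.denseTorus k).left :=
      inferInstanceAs (Nonempty (PrimeSpectrum (AddMonoidAlgebra k (Module.Dual ℤ v.lattice))))
    exact ⟨i ((v.torusIncl k).left t), hle ⟨_, rfl⟩, _,
      congr($(v.torusIncl_comp_of_comp_eq k hi) t).symm⟩
  refine (subset_closure_inter_of_isPreirreducible_of_isOpen hZ.isPreirreducible hW hne).trans ?_
  exact closure_minimal (fun x hx => v.mem_range_of_mem_chart k i hi x hx.2)
    i.isClosedEmbedding.isClosed_range

end TropicalExpansion.Vertex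

end Toric

end

theorem theorem1p3 {k : Type u} [Field k] [IsAlgClosed k] [CharZero k]
    {N L : Type u} [AddCommGroup N] [Module.Free ℤ N] [Module.Finite ℤ N]
    [AddCommGroup L] [Module.Free ℤ L] [Module.Finite ℤ L]
    (Sig : Fan N) (τ : BaseCone L) (Υ : TropicalExpansion Sig τ) (v : Υ.Vertex) :
    -- `Y_v` is an irreducible component of the central fibre
    (∃ i : (v.component k).left ⟶ Υ.centralFibre k, IsClosedImmersion i ∧
      i ≫ Υ.centralFibreIncl k = (v.componentIncl k).left ∧
      Set.range i ∈ irreducibleComponents (Υ.centralFibre k)) ∧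
    -- `T_v` is a dense open subscheme of `Y_v`
    IsOpenImmersion (v.torusIncl k).left ∧ IsDominant (v.torusIncl k).left ∧
    -- the inclusion `ι ⊗ 𝔾ₘ : T_{σ_v} → T_v`
    ∃ ι : latticeOf v.minimalCone →ₗ[ℤ] v.lattice,
      (∀ (g : latticeOf v.minimalCone) (h : L),
        ι (v.positionMap h - g) = Submodule.Quotient.mk ((g : N), h)) ∧
      Function.Injective ι ∧
      IsMonHom (torusMap k ι) ∧ IsClosedImmersion (torusMap k ι).left ∧
      -- the action of `T_v` on `Y_v` extending the multiplication of `T_v`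
      ∃ A : ModObj (v.denseTorus k) (v.component k),
        (v.denseTorus k ◁ v.torusIncl k) ≫ actionHom A =
          MonObj.mul ≫ v.torusIncl k ∧
        -- the rubber action on `Y_v`
        (torus L k ◁ v.componentIncl k) ≫ Υ.rubberAction k =
          ((torusMap k v.positionMap ≫ torusMap k ι) ▷ v.component k) ≫
            actionHom A ≫ v.componentIncl k := by
  obtain ⟨r, hr⟩ := v.exists_leftInverse_latticeEmbedding
  obtain ⟨A, hA, hT⟩ := exists_modObj_orbitClosure k Υ.fan ⟨v.cone, v.mem⟩
  refine ⟨v.exists_closedImmersion_centralFibre k, inferInstance, inferInstance,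
    v.latticeEmbedding, v.latticeEmbedding_positionMap_sub,
    Function.LeftInverse.injective (g := r) (LinearMap.congr_fun hr), inferInstance,
    isClosedImmersion_torusMap k _ r hr, A, hA, ?_⟩
  -- The big torus acts on `Y_v` through the quotient map, so `T_τ` acts through `mkQ ∘ inr`, which
  -- is `ι ∘ φ_v`.
  rw [TropicalExpansion.rubberAction, MonoidalCategory.whisker_exchange_assoc, hT,
    ← MonoidalCategory.comp_whiskerRight_assoc, torusMap_comp, torusMap_comp,
    v.mkQ_comp_inr]
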